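/- **Setup.** A *marked poset* $(P,A,\lambda)$ is a finite nonempty poset $P$ with a subset $A\subseteq P$ containing all minimal and all maximal elements of $P$ and an order-preserving map $\lambda:A\to\mathbb R$. Its *marked order polytope* is $$\mathcal O(P,A)_\lambda=\{x\in\mathbb R^P : x_p\le x_q \text{ for } p<q,\ x_a=\lambda(a)\text{ for } a\in A\}.$$ Let $\widehat P=P\sqcup\{\hat 0,\hat 1\}$ with a new smallest element $\hat 0$ and a new largest element $\hat 1$. These count as marked too, with markings $\lambda(\hat 0)=\min_A\lambda$ and $\lambda(\hat 1)=\max_A\lambda$. For $x\in\mathbb R^P$ put $x_{\hat 0}=\lambda(\hat 0)$ and $x_{\hat 1}=\lambda(\hat 1)$. A *bounded embedding* $H$ of $P$ is a planar drawing of the Hasse diagram of $\widehat P$ in which the $y$-coordinates of the vertices respect the order and every edge is a curve that is strictly monotone in $y$, together with two additional such edges between $\hat 0$ and $\hat 1$, one drawn to the left and one to the right of everything else. Faces are the connected components of the complement of the drawing. The left boundary of a bounded face $F$ consists of the edges that have $F$ immediately on their right and of their endpoints, so that it contains $\min F$ and $\max F$. $H$ is a *bounded strongly planar embedding* of $(P,A,\lambda)$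 if, for every bounded face $F$ whose left boundary contains a marked element, both $\min F$ and $\max F$ are marked. **The network $G_{(P,A,\lambda)}$.** Take the planar dual of $H$ without the vertex of the unbounded face. Direct the dual edge that crosses $p<q$ so that $q$ is on its right, that is, from the face on the right of that edge to the face on its left. Let $v_F$ be the vertex of the bounded face $F$. If the left boundary of $F$ has no marked element, $v_F$ has netflow $0$. Otherwise let $p_{i_1}>\dots>p_{i_g}$ be the marked elements of the left boundary, so $p_{i_1}=\max F$ and $p_{i_g}=\min F$. The vertex $v_F$ keeps only its incoming edges and gets netflow $-(\lambda(\max F)-\lambda(\min F))$. For $1\le m<g$ there is a new source $s^F_m$ of netflow $\lambda(p_{i_m})-\lambda(p_{i_{m+1}})$, from which the edges leave that previously left $v_F$ across the part of the left boundary between $p_{i_m}$ and $p_{i_{m+1}}$. Vertices without any edge are discarded; these are $v_F$ for the rightmost bounded face and the source of the leftmost bounded face. The *flow polytope* $\mathcal F_G$ is the set of all $f\in\mathbb R_{\ge0}^{E(G)}$ such that at each vertex the outgoing flow minus the incoming flow equals the netflow. **Theorem.** Let $H$ be a bounded strongly planar embedding of a marked poset $(P,A,\lambda)$, and let $G=G_{(P,A,\lambda)}$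 be the network above. Let $\Gamma:\mathbb R^P\to\mathbb R^{E(G)}$ be the affine map $x\mapsto f$ with $f(e)=x_q-x_p$ if $e$ crosses the edge $p<q$ of $H$. Then $\Gamma$ restricts to a bijection $\mathcal O(P,A)_\lambda\to\mathcal F_{G}$. If $\lambda$ takes integer values, then $\Gamma$ is an integral equivalence between $\mathcal O(P,A)_\lambda$ and $\mathcal F_{G}$. This means that both are integral polytopes (convex hulls of finitely many integer points) and that $\Gamma$ restricts to a bijection between them and to a bijection $\mathbb Z^P\cap\operatorname{aff}\mathcal O(P,A)_\lambda\to\mathbb Z^{E(G)}\cap\operatorname{aff}\mathcal F_{G}$. -/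

import Mathlib

open Topology

noncomputable section

/-! ### Marked posets and marked order polytopes -/

/-- A marking of a poset `P`: a set `A` of marked elements that contains all minimal and all
maximal elements of `P`, together with an order-preserving map `lam : A → ℝ`. -/
structure MarkedPoset (P : Type*) [PartialOrder P] where
  A : Set P
  extremal_mem : ∀ p : P, IsMin p ∨ IsMax p → p ∈ A
  lam : A → ℝ
  monotone_lam : Monotone lam

/-- `P` with a new smallest element `⊥` and a new largest element `⊤`. -/
abbrev Phat (P : Type*) : Type _ := WithBot (WithTop P)

namespace MarkedPoset

variable {P : Type*} [PartialOrder P] (M : MarkedPoset P)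

/-- The marked order polytope in `ℝ^P`. -/
def orderPolytope : Set (P → ℝ) :=
  {x | (∀ p q : P, p < q → x p ≤ x q) ∧ ∀ a : M.A, x a = M.lam a}

/-- The vector `x` in `ℝ^P`, extended to the new elements by the smallest marking on `⊥` and the
largest marking on `⊤`. -/
def extend (x : P → ℝ) : Phat P → ℝ :=
  WithBot.recBotCoe (⨅ a : M.A, M.lam a) (WithTop.recTopCoe (⨆ a : M.A, M.lam a) x)

/-- The marked elements of `Phat P`: those of `A`, and the two new elements. -/
def IsMarked (v : Phat P) : Prop :=
  v = ⊥ ∨ v = ⊤ ∨ ∃ a ∈ M.A, v = ((a : WithTop P) : Phat P)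

open Classical in
/-- The marking of a marked element of `Phat P` (the value `0` at an unmarked element is never
used). -/
def mark : Phat P → ℝ :=
  M.extend fun p => if h : p ∈ M.A then M.lam ⟨p, h⟩ else 0

end MarkedPoset

/-! ### Integral equivalence -/

/-- The points of `ℝ^ι` with integer coordinates. -/
def intLattice (ι : Type*) : Set (ι → ℝ) := {x | ∀ i, ∃ n : ℤ, x i = n}

/-- An integral polytope: the convex hull of finitely many lattice points. -/
def IsIntegralPolytope {ι : Type*} (S : Set (ι → ℝ)) : Prop :=
  ∃ V : Set (ι → ℝ), V.Finite ∧ V ⊆ intLattice ι ∧ S = convexHull ℝ V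

/-- The affine map `φ` is an integral equivalence between the integral polytopes `S` and `T`: it
restricts to a bijection from `S` to `T` and to a bijection between the lattice points of their
affine spans. -/
structure IsIntegralEquivalence {ι κ : Type*} (φ : (ι → ℝ) →ᵃ[ℝ] (κ → ℝ))
    (S : Set (ι → ℝ)) (T : Set (κ → ℝ)) : Prop where
  integral_left : IsIntegralPolytope S
  integral_right : IsIntegralPolytope T
  bijOn : Set.BijOn φ S T
  bijOn_lattice : Set.BijOn φ (intLattice ι ∩ (affineSpan ℝ S : Set (ι → ℝ)))
    (intLattice κ ∩ (affineSpan ℝ T : Set (κ → ℝ)))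

/-! ### Flow networks and flow polytopes -/

/-- A directed multigraph with vertices `V` and edges `E`, together with a netflow vector. -/
structure FlowNetwork (V E : Type*) where
  src : E → V
  tgt : E → V
  netflow : V → ℝ

open Classical in
/-- The flow polytope: all nonnegative `f` on the edges such that at every vertex the outgoing flow
minus the incoming flow is the netflow. -/
def FlowNetwork.flowPolytope {V E : Type*} [Fintype E] (N : FlowNetwork V E) : Set (E → ℝ) :=
  {f | (∀ e, 0 ≤ f e) ∧
    ∀ v, (∑ e with N.src e = v, f e) - (∑ e with N.tgt e = v, f e) = N.netflow v}

/-! ### Bounded embeddings -/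

/-- The edges to be drawn: the cover relations of `Phat P`, and two additional edges between
`⊥` and `⊤`. -/
def HEdge (P : Type*) [PartialOrder P] : Type _ :=
  {c : Phat P × Phat P // c.1 ⋖ c.2} ⊕ Bool

namespace HEdge

variable {P : Type*} [PartialOrder P]

/-- The lower endpoint of an edge. -/
def lo : HEdge P → Phat P
  | .inl c => c.1.1
  | .inr _ => ⊥

/-- The upper endpoint of an edge. -/
def hi : HEdge P → Phat P
  | .inl c => c.1.2
  | .inr _ => ⊤

/-- The additional edge that is drawn on the left. -/
def left : HEdge P := .inr false

/-- The additional edge that is drawn on the right. -/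
def right : HEdge P := .inr true

instance [Finite P] : Finite (HEdge P) :=
  inferInstanceAs (Finite ({c : Option (Option P) × Option (Option P) //
    @CovBy (Phat P) _ c.1 c.2} ⊕ Bool))

end HEdge

/-- A bounded embedding of `P`: a planar upward drawing of the Hasse diagram of `Phat P`, with two
additional edges between `⊥` and `⊤`, one to the left and one to the right of everything else.
The edge `e` is drawn as the curve of the points `(curve e t, t)`, where `t` runs from the
height of its lower endpoint to the height of its upper endpoint. -/
structure BoundedEmbedding (P : Type*) [PartialOrder P] where
  /-- The point that represents an element of `Phat P`. -/
  pos : Phat P → ℝ × ℝ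
  pos_injective : Function.Injective pos
  /-- The heights of the points respect the order. -/
  height_lt : ∀ p q : Phat P, p < q → (pos p).2 < (pos q).2
  /-- The horizontal coordinate of an edge as a function of the height. -/
  curve : HEdge P → ℝ → ℝ
  curve_continuousOn : ∀ e, ContinuousOn (curve e) (Set.Icc (pos e.lo).2 (pos e.hi).2)
  curve_lo : ∀ e, curve e (pos e.lo).2 = (pos e.lo).1
  curve_hi : ∀ e, curve e (pos e.hi).2 = (pos e.hi).1
  /-- The interiors of two edges do not meet. -/
  curve_ne_curve : ∀ e e', e ≠ e' → ∀ t ∈ Set.Ioo (pos e.lo).2 (pos e.hi).2,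
    t ∈ Set.Ioo (pos e'.lo).2 (pos e'.hi).2 → curve e t ≠ curve e' t
  /-- The interior of an edge contains no vertex. -/
  curve_ne_pos : ∀ e v, (pos v).2 ∈ Set.Ioo (pos e.lo).2 (pos e.hi).2 →
    curve e (pos v).2 ≠ (pos v).1
  left_lt : ∀ e, e ≠ HEdge.left → ∀ t ∈ Set.Ioo (pos e.lo).2 (pos e.hi).2,
    curve HEdge.left t < curve e t
  lt_right : ∀ e, e ≠ HEdge.right → ∀ t ∈ Set.Ioo (pos e.lo).2 (pos e.hi).2,
    curve e t < curve HEdge.right t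

namespace BoundedEmbedding

variable {P : Type*} [PartialOrder P] (H : BoundedEmbedding P)

/-- The part of the plane covered by the drawing. -/
def drawing : Set (ℝ × ℝ) :=
  Set.range H.pos ∪
    ⋃ e : HEdge P, (fun t => (H.curve e t, t)) '' Set.Icc (H.pos e.lo).2 (H.pos e.hi).2

/-- A bounded face: a bounded connected component of the complement of the drawing. -/
def IsBoundedFace (F : Set (ℝ × ℝ)) : Prop :=
  (∃ z ∈ H.drawingᶜ, F = connectedComponentIn H.drawingᶜ z) ∧ Bornology.IsBounded F

/-- The height of the middle of an edge. -/
def midHeight (e : HEdge P) : ℝ := ((H.pos e.lo).2 + (H.pos e.hi).2) / 2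

/-- The face immediately to the right of the edge `e`: the component of the complement of the
drawing that contains the points slightly to the right of the middle of `e`. -/
def rightFace (e : HEdge P) : Set (ℝ × ℝ) :=
  {z | ∀ᶠ ε in 𝓝[>] (0 : ℝ), z ∈ connectedComponentIn H.drawingᶜ
    (H.curve e (H.midHeight e) + ε, H.midHeight e)}

/-- The face immediately to the left of the edge `e`. -/
def leftFace (e : HEdge P) : Set (ℝ × ℝ) :=
  {z | ∀ᶠ ε in 𝓝[>] (0 : ℝ), z ∈ connectedComponentIn H.drawingᶜ
    (H.curve e (H.midHeight e) - ε, H.midHeight e)}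

/-- The elements on the left boundary of a face, its minimum and maximum included: the
endpoints of the edges that have the face on their right. -/
def leftBoundary (F : Set (ℝ × ℝ)) : Set (Phat P) :=
  {v | ∃ e : HEdge P, H.rightFace e = F ∧ (v = e.lo ∨ v = e.hi)}

/-- The elements on the boundary of a face. -/
def boundary (F : Set (ℝ × ℝ)) : Set (Phat P) :=
  {v | ∃ e : HEdge P, (H.rightFace e = F ∨ H.leftFace e = F) ∧ (v = e.lo ∨ v = e.hi)}

end BoundedEmbedding

open Classical in
/-- The greatest element of `S` (and `⊥` if there is none). -/
def greatestOf {Q : Type*} [PartialOrder Q] [OrderBot Q] (S : Set Q) : Q :=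
  if h : ∃ a, IsGreatest S a then h.choose else ⊥

open Classical in
/-- The least element of `S` (and `⊥` if there is none). -/
def leastOf {Q : Type*} [PartialOrder Q] [OrderBot Q] (S : Set Q) : Q :=
  if h : ∃ a, IsLeast S a then h.choose else ⊥

namespace BoundedEmbedding

variable {P : Type*} [PartialOrder P] (H : BoundedEmbedding P) (M : MarkedPoset P)

/-- The maximum element of a face. -/
def faceMax (F : Set (ℝ × ℝ)) : Phat P := greatestOf (H.boundary F)

/-- The minimum element of a face. -/
def faceMin (F : Set (ℝ × ℝ)) : Phat P := leastOf (H.boundary F)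

/-- The left boundary of the face `F` contains a marked element. -/
def LeftMarked (F : Set (ℝ × ℝ)) : Prop := ∃ v ∈ H.leftBoundary F, M.IsMarked v

/-- `H` is a bounded strongly planar embedding of the marked poset: every bounded face whose left
boundary contains a marked element has a marked minimum and a marked maximum. -/
def IsBoundedStronglyPlanar : Prop :=
  ∀ F, H.IsBoundedFace F → H.LeftMarked M F →
    M.IsMarked (H.faceMin F) ∧ M.IsMarked (H.faceMax F)

/-! ### The flow network of a bounded strongly planar embedding -/

/-- The edges of the planar dual of `H` that remain when the vertex of the unbounded face is
deleted; a dual edge is given by the edge of `H` that it crosses. -/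
def DualEdge : Type _ :=
  {e : HEdge P // Bornology.IsBounded (H.rightFace e) ∧ Bornology.IsBounded (H.leftFace e)}

instance [Finite P] : Fintype H.DualEdge :=
  haveI : Finite H.DualEdge := Subtype.finite
  Fintype.ofFinite _

/-- The labels of the vertices of the network: `face F` is the vertex `v_F` of the face `F`, and
`source F b a` is the source that was split off from `v_F` for the part of the left boundary
of `F` between the consecutive marked elements `b > a`. -/
inductive VertexLabel (P : Type*) where
  | face (F : Set (ℝ × ℝ))
  | source (F : Set (ℝ × ℝ)) (b a : Phat P)

open Classical in
/-- Dual edges are directed from right to left, so that they have the larger endpoint of the crossed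
edge on their right-hand side. The dual edge that crosses `e` leaves `v_F`, where `F` is the
face on the right of `e`, if the left boundary of `F` has no marked element. Otherwise it
leaves the source for the marked elements of the left boundary of `F` next above and next
below `e`. -/
def srcLabel (e : H.DualEdge) : VertexLabel P :=
  let F := H.rightFace e.1
  if H.LeftMarked M F then
    .source F (leastOf {v | v ∈ H.leftBoundary F ∧ M.IsMarked v ∧ e.1.hi ≤ v})
      (greatestOf {v | v ∈ H.leftBoundary F ∧ M.IsMarked v ∧ v ≤ e.1.lo})
  else .face F

/-- The dual edge that crosses `e` enters `v_F`, where `F` is the face on the left of `e`. -/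
def tgtLabel (e : H.DualEdge) : VertexLabel P := .face (H.leftFace e.1)

/-- The vertices of the network: the labels at which there is an edge. The labels without
an edge would be `v_F` for the rightmost bounded face `F`, into which no edge leads (its other side
is the unbounded face), and the source of the leftmost bounded face, which would have no edge for
the same reason. -/
def Vertex : Type _ :=
  {v : VertexLabel P // ∃ e : H.DualEdge, H.srcLabel M e = v ∨ H.tgtLabel e = v}

open Classical in
/-- The netflow: `v_F` is a sink of netflow minus the difference of the markings of the maximum and
the minimum of `F` if the left boundary of `F` has a marked element, and has netflow `0`
otherwise; the source between consecutive marked elements `b > a` has netflow the difference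
of their markings. -/
def netflowLabel : VertexLabel P → ℝ
  | .face F => if H.LeftMarked M F then -(M.mark (H.faceMax F) - M.mark (H.faceMin F)) else 0
  | .source _ b a => M.mark b - M.mark a

/-- The flow network of the embedding `H` of a marked poset. -/
def network : FlowNetwork (H.Vertex M) H.DualEdge where
  src e := ⟨H.srcLabel M e, e, Or.inl rfl⟩
  tgt e := ⟨H.tgtLabel e, e, Or.inr rfl⟩
  netflow v := H.netflowLabel M v.1

end BoundedEmbedding

end

noncomputable section

open Set Filter

/-! A point `x` of the order polytope is a potential, and `Γ` takes its differences along the edges.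
Both boundaries of a face run from its minimum to its maximum, so the differences along either of
them add up to the same number. This is conservation at `v_F`. Between consecutive marked elements
the sum telescopes to the difference of the markings, which is the netflow of the source.
Monotonicity of `x` is nonnegativity of the flow.

Conversely, a flow has equal sums over the left and the right boundary of every face with dual edges
on both sides. Without marked elements on the left boundary this is conservation at `v_F`. With
marked elements, strong planarity makes `max F` and `min F` marked, so the sources exhaust the left
boundary and emit in total what the sink `v_F` absorbs (`IsCell.sum_left_eq`,
`IsCell.sum_left_eq_sum_right`). Hence the flow is the difference of a potential
(`exists_potential`): the value at `v` may be computed along any edge into `v`, because two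
neighbouring edges into `v` enclose a face with maximum `v`, below which the potential is already
known. Normalized at `⊥`, the potential has the right value at every marked `v`: the face to the
right of an edge into `v` has a marked minimum `u < v`, and the sources between `u` and `v`
determine the difference (`exists_mem_orderPolytope`).

The plane topology is handled through monotone paths from bottom to top. They form a finite lattice
of functions of the height. Between the greatest path to the left of a point and the least path to
its right lies a cell that contains the point (`exists_isCell`), and a cell is a whole component of
the complement (`IsCell.connectedComponentIn_eq`). So the faces next to dual edges are cells, whose
two boundaries are arcs along which sums telescope (`IsArc.sum_eq_sub`).

For integral markings, `Γ` is injective and both preserves and reflects integrality, since every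
element is reached from `⊥` by edges. It remains that the order polytope is integral
(`extremePoints_subset_intLattice`): all coordinates with the same nonzero fractional part can be
moved together in both directions. -/

instance Phat.finite (P : Type*) [Finite P] : Finite (Phat P) :=
  inferInstanceAs (Finite (Option (Option P)))

namespace HEdge

variable {P : Type*} [PartialOrder P]

theorem lo_lt_hi : ∀ e : HEdge P, e.lo < e.hi
  | .inl c => c.2.lt
  | .inr _ => WithBot.bot_lt_coe (⊤ : WithTop P)

end HEdge

/-! ### Local structure of the drawing -/

namespace BoundedEmbedding

variable {P : Type*} [PartialOrder P] (H : BoundedEmbedding P)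

theorem height_lo_lt_hi (e : HEdge P) : (H.pos e.lo).2 < (H.pos e.hi).2 :=
  H.height_lt _ _ e.lo_lt_hi

theorem midHeight_mem (e : HEdge P) :
    H.midHeight e ∈ Ioo (H.pos e.lo).2 (H.pos e.hi).2 := by
  have := H.height_lo_lt_hi e
  constructor <;> unfold midHeight <;> linarith

theorem height_mono {p q : Phat P} (h : p ≤ q) : (H.pos p).2 ≤ (H.pos q).2 := by
  rcases h.eq_or_lt with rfl | h
  · exact le_rfl
  · exact (H.height_lt _ _ h).le

theorem height_bot_lt_top : (H.pos ⊥).2 < (H.pos ⊤).2 :=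
  H.height_lo_lt_hi HEdge.left

theorem pos_mem_drawing (v : Phat P) : H.pos v ∈ H.drawing := Or.inl ⟨v, rfl⟩

theorem curve_mem_drawing {e : HEdge P} {t : ℝ} (ht : t ∈ Icc (H.pos e.lo).2 (H.pos e.hi).2) :
    (H.curve e t, t) ∈ H.drawing :=
  Or.inr (mem_iUnion.2 ⟨e, t, ht, rfl⟩)

theorem exists_of_mem_drawing {z : ℝ × ℝ} (hz : z ∈ H.drawing) :
    (∃ v, H.pos v = z) ∨
      ∃ e : HEdge P, z.2 ∈ Ioo (H.pos e.lo).2 (H.pos e.hi).2 ∧ H.curve e z.2 = z.1 := by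
  rcases hz with ⟨v, rfl⟩ | hz
  · exact Or.inl ⟨v, rfl⟩
  · obtain ⟨e, t, ht, rfl⟩ := mem_iUnion.1 hz
    rcases ht.1.eq_or_lt with h | h
    · exact Or.inl ⟨e.lo, Prod.ext (by simp only [← h, H.curve_lo]) h⟩
    rcases ht.2.eq_or_lt with h' | h'
    · exact Or.inl ⟨e.hi, Prod.ext (by simp only [h', H.curve_hi]) h'.symm⟩
    exact Or.inr ⟨e, ⟨h, h'⟩, rfl⟩

theorem isClosed_edge (e : HEdge P) :
    IsClosed ((fun t => (H.curve e t, t)) '' Icc (H.pos e.lo).2 (H.pos e.hi).2) :=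
  (isCompact_Icc.image_of_continuousOn
    ((H.curve_continuousOn e).prodMk continuousOn_id)).isClosed

section

variable [Finite P]

/-- Near an interior point of an edge, the drawing consists of this edge only. -/
theorem eventually_eq_curve (e : HEdge P) {t : ℝ}
    (ht : t ∈ Ioo (H.pos e.lo).2 (H.pos e.hi).2) :
    ∀ᶠ z in 𝓝 (H.curve e t, t), z ∈ H.drawing → z.1 = H.curve e z.2 := by
  -- `K` consists of the vertices and all other edges. It is closed by finiteness and misses the
  -- given point, so a neighbourhood of the point meets only `e`.
  let K : Set (ℝ × ℝ) := range H.pos ∪ ⋃ e' : {e' : HEdge P // e' ≠ e},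
    (fun t => (H.curve e'.1 t, t)) '' Icc (H.pos e'.1.lo).2 (H.pos e'.1.hi).2
  have hK : IsClosed K :=
    (finite_range _).isClosed.union (isClosed_iUnion_of_finite fun e' => H.isClosed_edge e'.1)
  have hv : ∀ v, H.pos v ≠ (H.curve e t, t) := by
    intro v hv
    have h2 : (H.pos v).2 = t := by rw [hv]
    exact H.curve_ne_pos e v (h2 ▸ ht) (by rw [hv])
  have hz : (H.curve e t, t) ∉ K := by
    rintro (⟨v, h⟩ | h)
    · exact hv v h
    · obtain ⟨⟨e', he'⟩, s, hs, h⟩ := mem_iUnion.1 h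
      obtain ⟨h1, rfl⟩ := Prod.ext_iff.1 h
      simp only at h1 hs
      rcases hs.1.eq_or_lt with h3 | h3
      · exact hv e'.lo (Prod.ext (by rw [← H.curve_lo, h3, h1]) h3)
      rcases hs.2.eq_or_lt with h4 | h4
      · exact hv e'.hi (Prod.ext (by rw [← H.curve_hi, ← h4, h1]) h4.symm)
      exact H.curve_ne_curve e' e he' s ⟨h3, h4⟩ ht h1
  filter_upwards [hK.isOpen_compl.mem_nhds hz] with z hzK hzD
  rcases hzD with h | h
  · exact absurd (Or.inl h) hzK
  · obtain ⟨e', s, hs, rfl⟩ := mem_iUnion.1 h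
    by_cases hee : e' = e
    · subst hee; rfl
    · exact (hzK (Or.inr (mem_iUnion.2 ⟨⟨e', hee⟩, s, hs, rfl⟩))).elim

/-- A continuous function whose graph is in the drawing and that agrees with an edge at one
interior point of the edge agrees with it everywhere. -/
theorem eq_curve_of_eq_curve {l : ℝ → ℝ} (hl : Continuous l) {I : Set ℝ} (hI : I.OrdConnected)
    (hD : ∀ t ∈ I, (l t, t) ∈ H.drawing) {e : HEdge P} {t₀ : ℝ} (ht₀ : t₀ ∈ I)
    (ht₀' : t₀ ∈ Ioo (H.pos e.lo).2 (H.pos e.hi).2) (h₀ : l t₀ = H.curve e t₀) {t : ℝ}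
    (ht : t ∈ I) (ht' : t ∈ Ioo (H.pos e.lo).2 (H.pos e.hi).2) : l t = H.curve e t := by
  let J := I ∩ Ioo (H.pos e.lo).2 (H.pos e.hi).2
  have hJ : IsPreconnected J := (hI.inter ordConnected_Ioo).isPreconnected
  have : PreconnectedSpace J := isPreconnected_iff_preconnectedSpace.1 hJ
  have hc : Continuous fun s : J => H.curve e s :=
    ((H.curve_continuousOn e).mono (inter_subset_right.trans Ioo_subset_Icc_self)).domRestrict
  let A : Set J := {s | l s = H.curve e s}
  -- Agreement is an open condition because near an interior point of `e` the drawing is `e` alone.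
  have hA : IsClopen A := by
    refine ⟨isClosed_eq (hl.comp continuous_subtype_val) hc, isOpen_iff_mem_nhds.2 ?_⟩
    intro s hs
    have hg : Tendsto (fun s : J => (l s, (s : ℝ))) (𝓝 s) (𝓝 (H.curve e s, (s : ℝ))) := by
      have : ContinuousAt (fun s : J => (l s, (s : ℝ))) s :=
        ((hl.comp continuous_subtype_val).prodMk continuous_subtype_val).continuousAt
      rw [← (show l s = H.curve e s from hs)]
      exact this
    filter_upwards [hg.eventually (H.eventually_eq_curve e s.2.2)] with s' hs'
    exact hs' (hD _ s'.2.1)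
  have := hA.eq_univ ⟨⟨t₀, ht₀, ht₀'⟩, h₀⟩
  exact (this ▸ mem_univ (⟨t, ht, ht'⟩ : J) : (⟨t, ht, ht'⟩ : J) ∈ A)

end

/-! ### Paths -/

/-- A path of the drawing from bottom to top, as a function of the height; it is continued by
constants. -/
structure IsPath (γ : ℝ → ℝ) : Prop where
  continuous : Continuous γ
  eq_bot : ∀ t ≤ (H.pos ⊥).2, γ t = (H.pos ⊥).1
  eq_top : ∀ t ≥ (H.pos ⊤).2, γ t = (H.pos ⊤).1
  mem : ∀ t ∈ Icc (H.pos ⊥).2 (H.pos ⊤).2, (γ t, t) ∈ H.drawing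

variable {H}

/-- At each height the maximum is one of the two values, so its graph stays in the drawing; how the
paths cross is irrelevant. Closure under `⊔` and `⊓` provides extremal paths on either side of a
point. -/
theorem IsPath.sup {γ γ' : ℝ → ℝ} (h : H.IsPath γ) (h' : H.IsPath γ') : H.IsPath (γ ⊔ γ') where
  continuous := h.continuous.max h'.continuous
  eq_bot t ht := by simp [h.eq_bot t ht, h'.eq_bot t ht]
  eq_top t ht := by simp [h.eq_top t ht, h'.eq_top t ht]
  mem t ht := by
    rcases le_total (γ t) (γ' t) with hh | hh
    · simpa [hh] using h'.mem t ht
    · simpa [hh] using h.mem t ht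

theorem IsPath.inf {γ γ' : ℝ → ℝ} (h : H.IsPath γ) (h' : H.IsPath γ') : H.IsPath (γ ⊓ γ') where
  continuous := h.continuous.min h'.continuous
  eq_bot t ht := by simp [h.eq_bot t ht, h'.eq_bot t ht]
  eq_top t ht := by simp [h.eq_top t ht, h'.eq_top t ht]
  mem t ht := by
    rcases le_total (γ t) (γ' t) with hh | hh
    · simpa [hh] using h.mem t ht
    · simpa [hh] using h'.mem t ht

variable (H)

theorem Ioo_subset_Icc_bot_top (e : HEdge P) :
    Ioo (H.pos e.lo).2 (H.pos e.hi).2 ⊆ Icc (H.pos ⊥).2 (H.pos ⊤).2 :=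
  Ioo_subset_Icc_self.trans (Icc_subset_Icc (H.height_mono bot_le) (H.height_mono le_top))

/-- Off the finitely many vertex heights a path runs inside an edge, and then it also passes through
the middle of that edge. So the set of edges whose middle it meets determines the path on a dense
set, hence everywhere by continuity. -/
theorem finite_isPath [Finite P] : {γ | H.IsPath γ}.Finite := by
  refine Finite.of_finite_image (f := fun γ => {e : HEdge P | γ (H.midHeight e) =
    H.curve e (H.midHeight e)}) (toFinite _) ?_
  intro γ hγ γ' hγ' heq
  have key : ∀ δ δ' : ℝ → ℝ, H.IsPath δ → H.IsPath δ' →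
      {e : HEdge P | δ (H.midHeight e) = H.curve e (H.midHeight e)} =
      {e : HEdge P | δ' (H.midHeight e) = H.curve e (H.midHeight e)} →
      ∀ t ∈ (range fun v => (H.pos v).2)ᶜ, δ t = δ' t := by
    intro δ δ' hδ hδ' heq t ht
    by_cases h1 : t ≤ (H.pos ⊥).2
    · rw [hδ.eq_bot t h1, hδ'.eq_bot t h1]
    by_cases h2 : (H.pos ⊤).2 ≤ t
    · rw [hδ.eq_top t h2, hδ'.eq_top t h2]
    have hI : t ∈ Icc (H.pos ⊥).2 (H.pos ⊤).2 := ⟨(not_le.1 h1).le, (not_le.1 h2).le⟩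
    rcases H.exists_of_mem_drawing (hδ.mem t hI) with ⟨v, hv⟩ | ⟨e, he, hee⟩
    · exact absurd ⟨v, by simp [hv]⟩ ht
    · have hm := H.midHeight_mem e
      have hmI := H.Ioo_subset_Icc_bot_top e hm
      have h3 : e ∈ {e : HEdge P | δ (H.midHeight e) = H.curve e (H.midHeight e)} :=
        H.eq_curve_of_eq_curve hδ.continuous ordConnected_Icc hδ.mem hI he hee.symm hmI hm
      rw [heq] at h3
      rw [H.eq_curve_of_eq_curve hδ'.continuous ordConnected_Icc hδ'.mem hmI hm h3 hI he]
      exact hee.symm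
  have hd : Dense (range fun v => (H.pos v).2)ᶜ :=
    (finite_range _).countable.dense_compl ℝ
  exact hγ.continuous.ext_on hd hγ'.continuous (key γ γ' hγ hγ' heq)

/-- A continuous function on the line that agrees with the edge on the heights of the edge. -/
theorem exists_continuous_eqOn_curve (e : HEdge P) :
    ∃ g : ℝ → ℝ, Continuous g ∧ EqOn g (H.curve e) (Icc (H.pos e.lo).2 (H.pos e.hi).2) :=
  ⟨IccExtend (H.height_lo_lt_hi e).le ((Icc (H.pos e.lo).2 (H.pos e.hi).2).domRestrict (H.curve e)),
    (H.curve_continuousOn e).domRestrict.Icc_extend',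
    fun t ht => by rw [IccExtend_of_mem _ _ ht]; rfl⟩

variable [Finite P]

theorem exists_edge_hi {v : Phat P} (hv : v ≠ ⊥) : ∃ c : {c : Phat P × Phat P // c.1 ⋖ c.2},
    c.1.2 = v := by
  obtain ⟨u, -, hu⟩ := exists_le_covBy_of_lt (bot_lt_iff_ne_bot.2 hv)
  exact ⟨⟨(u, v), hu⟩, rfl⟩

theorem exists_edge_lo {v : Phat P} (hv : v ≠ ⊤) : ∃ c : {c : Phat P × Phat P // c.1 ⋖ c.2},
    c.1.1 = v := by
  obtain ⟨u, hu, -⟩ := exists_covBy_le_of_lt (lt_top_iff_ne_top.2 hv)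
  exact ⟨⟨(v, u), hu⟩, rfl⟩

/-- Induction along cover relations: a path up to an element covered by `v` is prolonged by the edge
into `v`. -/
theorem exists_path_below (v : Phat P) : ∃ γ : ℝ → ℝ, Continuous γ ∧
    (∀ t ≤ (H.pos ⊥).2, γ t = (H.pos ⊥).1) ∧ γ (H.pos v).2 = (H.pos v).1 ∧
    ∀ t ∈ Icc (H.pos ⊥).2 (H.pos v).2, (γ t, t) ∈ H.drawing := by
  induction v using WellFoundedLT.induction with
  | ind v ih =>
  by_cases hv : v = ⊥
  · subst hv
    refine ⟨fun _ => (H.pos ⊥).1, continuous_const, fun _ _ => rfl, rfl, fun t ht => ?_⟩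
    rw [Icc_self, mem_singleton_iff] at ht
    subst ht
    exact H.pos_mem_drawing ⊥
  · obtain ⟨c, rfl⟩ := exists_edge_hi hv
    let e : HEdge P := .inl c
    obtain ⟨γ, h1, h2, h3, h4⟩ := ih e.lo e.lo_lt_hi
    obtain ⟨g, hg, hge⟩ := H.exists_continuous_eqOn_curve e
    have hlt := H.height_lo_lt_hi e
    refine ⟨fun t => if t ≤ (H.pos e.lo).2 then γ t else g t,
      h1.if_le hg continuous_id continuous_const ?_, ?_, ?_, ?_⟩
    · rintro t rfl
      rw [h3, hge ⟨le_rfl, hlt.le⟩, H.curve_lo]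
    · intro t ht
      simp [ht.trans (H.height_mono bot_le), h2 t ht]
    · change (if (H.pos e.hi).2 ≤ (H.pos e.lo).2 then _ else g (H.pos e.hi).2) = (H.pos e.hi).1
      rw [if_neg hlt.not_ge, hge ⟨hlt.le, le_rfl⟩, H.curve_hi]
    · intro t ht
      dsimp only
      split_ifs with h
      · exact h4 t ⟨ht.1, h⟩
      · have : t ∈ Icc (H.pos e.lo).2 (H.pos e.hi).2 := ⟨(not_le.1 h).le, ht.2⟩
        rw [hge this]
        exact H.curve_mem_drawing this

theorem exists_path_above (v : Phat P) : ∃ γ : ℝ → ℝ, Continuous γ ∧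
    (∀ t ≥ (H.pos ⊤).2, γ t = (H.pos ⊤).1) ∧ γ (H.pos v).2 = (H.pos v).1 ∧
    ∀ t ∈ Icc (H.pos v).2 (H.pos ⊤).2, (γ t, t) ∈ H.drawing := by
  induction v using WellFoundedGT.induction with
  | ind v ih =>
  by_cases hv : v = ⊤
  · subst hv
    refine ⟨fun _ => (H.pos ⊤).1, continuous_const, fun _ _ => rfl, rfl, fun t ht => ?_⟩
    rw [Icc_self, mem_singleton_iff] at ht
    subst ht
    exact H.pos_mem_drawing ⊤
  · obtain ⟨c, rfl⟩ := exists_edge_lo hv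
    let e : HEdge P := .inl c
    obtain ⟨γ, h1, h2, h3, h4⟩ := ih e.hi e.lo_lt_hi
    obtain ⟨g, hg, hge⟩ := H.exists_continuous_eqOn_curve e
    have hlt := H.height_lo_lt_hi e
    refine ⟨fun t => if t ≤ (H.pos e.hi).2 then g t else γ t,
      hg.if_le h1 continuous_id continuous_const ?_, ?_, ?_, ?_⟩
    · rintro t rfl
      rw [h3, hge ⟨hlt.le, le_rfl⟩, H.curve_hi]
    · intro t ht
      rcases ((H.height_mono le_top).trans ht : (H.pos e.hi).2 ≤ t).eq_or_lt with h | h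
      · simp only [h, le_refl, if_true]
        rw [← h2 t ht, ← h, h3, hge ⟨hlt.le, le_rfl⟩, H.curve_hi]
      · simp only [h.not_ge, if_false, h2 t ht]
    · change (if (H.pos e.lo).2 ≤ (H.pos e.hi).2 then g (H.pos e.lo).2 else _) = (H.pos e.lo).1
      rw [if_pos hlt.le, hge ⟨le_rfl, hlt.le⟩, H.curve_lo]
    · intro t ht
      dsimp only
      split_ifs with h
      · have : t ∈ Icc (H.pos e.lo).2 (H.pos e.hi).2 := ⟨ht.1, h⟩
        rw [hge this]
        exact H.curve_mem_drawing this
      · exact h4 t ⟨(not_le.1 h).le, ht.2⟩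

theorem exists_path_curve (e : HEdge P) : ∃ γ, H.IsPath γ ∧
    EqOn γ (H.curve e) (Icc (H.pos e.lo).2 (H.pos e.hi).2) := by
  obtain ⟨γ, h1, h2, h3, h4⟩ := H.exists_path_below e.lo
  obtain ⟨δ, k1, k2, k3, k4⟩ := H.exists_path_above e.hi
  obtain ⟨g, hg, hge⟩ := H.exists_continuous_eqOn_curve e
  have hlt := H.height_lo_lt_hi e
  have e1 : EqOn (fun t => if t ≤ (H.pos e.lo).2 then γ t else
      if t ≤ (H.pos e.hi).2 then g t else δ t) (H.curve e)
      (Icc (H.pos e.lo).2 (H.pos e.hi).2) := by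
    intro t ht
    rcases ht.1.eq_or_lt with h | h
    · simp only [← h, le_refl, if_true, h3, H.curve_lo]
    · simp only [h.not_ge, if_false, ht.2, if_true, hge ht]
  have e2 : ∀ t ≥ (H.pos e.hi).2, (if t ≤ (H.pos e.lo).2 then γ t else
      if t ≤ (H.pos e.hi).2 then g t else δ t) = δ t := by
    intro t ht
    rcases ht.eq_or_lt with h | h
    · subst h
      rw [if_neg hlt.not_ge, if_pos le_rfl, k3, hge ⟨hlt.le, le_rfl⟩, H.curve_hi]
    · rw [if_neg (hlt.trans h).not_ge, if_neg h.not_ge]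
  refine ⟨fun t => if t ≤ (H.pos e.lo).2 then γ t else
      if t ≤ (H.pos e.hi).2 then g t else δ t, ⟨h1.if_le
      (hg.if_le k1 continuous_id continuous_const ?_) continuous_id continuous_const ?_, ?_, ?_, ?_⟩, e1⟩
  · rintro t rfl
    rw [k3, hge ⟨hlt.le, le_rfl⟩, H.curve_hi]
  · rintro t rfl
    rw [if_pos hlt.le, h3, hge ⟨le_rfl, hlt.le⟩, H.curve_lo]
  · intro t ht
    simp [ht.trans (H.height_mono bot_le), h2 t ht]
  · intro t ht
    rw [e2 t ((H.height_mono le_top).trans ht), k2 t ht]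
  · intro t ht
    by_cases ha : t ≤ (H.pos e.lo).2
    · rw [if_pos ha]
      exact h4 t ⟨ht.1, ha⟩
    · by_cases hb : t ≤ (H.pos e.hi).2
      · have hc : t ∈ Icc (H.pos e.lo).2 (H.pos e.hi).2 := ⟨(not_le.1 ha).le, hb⟩
        have := e1 hc
        simp only at this
        rw [this]
        exact H.curve_mem_drawing hc
      · rw [e2 t (not_le.1 hb).le]
        exact k4 t ⟨(not_le.1 hb).le, ht.2⟩

theorem exists_edge_of_mem_drawing {z : ℝ × ℝ} (hz : z ∈ H.drawing) :
    ∃ e : HEdge P, z.2 ∈ Icc (H.pos e.lo).2 (H.pos e.hi).2 ∧ H.curve e z.2 = z.1 := by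
  rcases H.exists_of_mem_drawing hz with ⟨v, rfl⟩ | ⟨e, he, hz⟩
  · by_cases hv : v = ⊥
    · subst hv
      exact ⟨.left, ⟨le_rfl, H.height_bot_lt_top.le⟩, H.curve_lo .left⟩
    · obtain ⟨c, rfl⟩ := exists_edge_hi hv
      exact ⟨.inl c, ⟨(H.height_lo_lt_hi (.inl c)).le, le_rfl⟩, H.curve_hi (.inl c)⟩
  · exact ⟨e, Ioo_subset_Icc_self he, hz⟩

theorem exists_path_of_mem_drawing {z : ℝ × ℝ} (hz : z ∈ H.drawing) :
    ∃ γ, H.IsPath γ ∧ γ z.2 = z.1 := by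
  obtain ⟨e, he, hz⟩ := H.exists_edge_of_mem_drawing hz
  obtain ⟨γ, hγ, hγe⟩ := H.exists_path_curve e
  exact ⟨γ, hγ, by rw [hγe he, hz]⟩

end BoundedEmbedding

theorem SupClosed.exists_isGreatest {α : Type*} [SemilatticeSup α] {s : Set α} (hs : SupClosed s)
    (hf : s.Finite) (hne : s.Nonempty) : ∃ a, IsGreatest s a := by
  have hne' : hf.toFinset.Nonempty := by simpa using hne
  refine ⟨hf.toFinset.sup' hne' id, hs.finsetSup'_mem hne' (by simp), fun a ha => ?_⟩
  exact Finset.le_sup' id (by simpa using ha)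

theorem InfClosed.exists_isLeast {α : Type*} [SemilatticeInf α] {s : Set α} (hs : InfClosed s)
    (hf : s.Finite) (hne : s.Nonempty) : ∃ a, IsLeast s a := by
  have hne' : hf.toFinset.Nonempty := by simpa using hne
  refine ⟨hf.toFinset.inf' hne' id, hs.finsetInf'_mem hne' (by simp), fun a ha => ?_⟩
  exact Finset.inf'_le id (by simpa using ha)

/-! ### Arcs and cells -/

namespace BoundedEmbedding

variable {P : Type*} [PartialOrder P] (H : BoundedEmbedding P)

/-- The graph of `l` runs inside the drawing from the vertex `u` up to the vertex `w`. -/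
structure IsArc (u w : Phat P) (l : ℝ → ℝ) : Prop where
  height_lt : (H.pos u).2 < (H.pos w).2
  continuous : Continuous l
  mem : ∀ t ∈ Icc (H.pos u).2 (H.pos w).2, (l t, t) ∈ H.drawing
  eq_lo : l (H.pos u).2 = (H.pos u).1
  eq_hi : l (H.pos w).2 = (H.pos w).1

/-- The open region between two arcs from `u` to `w`. -/
def region (u w : Phat P) (l r : ℝ → ℝ) : Set (ℝ × ℝ) :=
  {z | z.2 ∈ Ioo (H.pos u).2 (H.pos w).2 ∧ l z.2 < z.1 ∧ z.1 < r z.2}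

/-- The two arcs from `u` to `w` bound a region that does not meet the drawing. -/
structure IsCell (u w : Phat P) (l r : ℝ → ℝ) : Prop where
  left : H.IsArc u w l
  right : H.IsArc u w r
  lt : ∀ t ∈ Ioo (H.pos u).2 (H.pos w).2, l t < r t
  notMem : ∀ z ∈ H.region u w l r, z ∉ H.drawing

variable {H}

/-- A region of a cell is a connected component of the complement of the drawing. -/
theorem IsCell.connectedComponentIn_eq {u w : Phat P} {l r : ℝ → ℝ} (h : H.IsCell u w l r)
    {z : ℝ × ℝ} (hz : z ∈ H.region u w l r) :
    connectedComponentIn H.drawingᶜ z = H.region u w l r := by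
  have hl := h.left.continuous
  have hr := h.right.continuous
  have hopen : IsOpen (H.region u w l r) :=
    (isOpen_Ioo.preimage continuous_snd).inter
      ((isOpen_lt (hl.comp continuous_snd) continuous_fst).inter
        (isOpen_lt continuous_fst (hr.comp continuous_snd)))
  have hconn : IsPreconnected (H.region u w l r) := by
    -- The region is the image of an open rectangle under interpolation between `l` and `r`, hence
    -- connected.
    have himg : H.region u w l r = (fun p : ℝ × ℝ => (l p.2 + p.1 * (r p.2 - l p.2), p.2)) ''
        (Ioo (0 : ℝ) 1 ×ˢ Ioo (H.pos u).2 (H.pos w).2) := by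
      ext ⟨x, t⟩
      constructor
      · rintro ⟨h1, h2, h3⟩
        simp only at h1 h2 h3
        have h4 : 0 < r t - l t := by linarith
        refine ⟨((x - l t) / (r t - l t), t), ⟨⟨div_pos (by linarith) h4, ?_⟩, h1⟩, ?_⟩
        · rw [div_lt_one h4]; linarith
        · simp only
          rw [div_mul_cancel₀ _ h4.ne']
          simp
      · rintro ⟨⟨s, t'⟩, ⟨⟨h1, h2⟩, h3⟩, heq⟩
        simp only [Prod.mk.injEq] at heq h1 h2 h3
        obtain ⟨rfl, rfl⟩ := heq
        have h4 := h.lt _ h3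
        refine ⟨h3, ?_, ?_⟩ <;> simp only
        · nlinarith
        · nlinarith
    rw [himg]
    refine (isPreconnected_Ioo.prod isPreconnected_Ioo).image _ (Continuous.continuousOn ?_)
    fun_prop
  have hsub : H.region u w l r ⊆ H.drawingᶜ := h.notMem
  refine subset_antisymm ?_ (hconn.subset_connectedComponentIn hz hsub)
  -- It suffices that the region is relatively closed in the complement of the drawing: a limit
  -- point outside the region would lie on one of the arcs.
  refine isPreconnected_connectedComponentIn.subset_of_closure_inter_subset hopen
    ⟨z, mem_connectedComponentIn (hsub hz), hz⟩ ?_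
  rintro ⟨x, t⟩ ⟨hc, hx⟩
  have hxD : (x, t) ∉ H.drawing := connectedComponentIn_subset _ _ hx
  have hcl : IsClosed {z : ℝ × ℝ | z.2 ∈ Icc (H.pos u).2 (H.pos w).2 ∧ l z.2 ≤ z.1 ∧
      z.1 ≤ r z.2} :=
    (isClosed_Icc.preimage continuous_snd).inter
      ((isClosed_le (hl.comp continuous_snd) continuous_fst).inter
        (isClosed_le continuous_fst (hr.comp continuous_snd)))
  have hle : H.region u w l r ⊆ {z : ℝ × ℝ | z.2 ∈ Icc (H.pos u).2 (H.pos w).2 ∧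
      l z.2 ≤ z.1 ∧ z.1 ≤ r z.2} :=
    fun z hz => ⟨Ioo_subset_Icc_self hz.1, hz.2.1.le, hz.2.2.le⟩
  obtain ⟨h1, h2, h3⟩ := closure_minimal hle hcl hc
  simp only at h1 h2 h3
  have h4 : l t ≠ x := fun hh => hxD (hh ▸ h.left.mem t h1)
  have h5 : x ≠ r t := fun hh => hxD (hh ▸ h.right.mem t h1)
  have h6 := lt_of_le_of_ne h2 h4
  have h7 := lt_of_le_of_ne h3 h5
  -- At the lowest and the highest level the two arcs meet in a vertex, which leaves no room for `l
  -- t < x < r t`.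
  refine ⟨⟨lt_of_le_of_ne h1.1 ?_, lt_of_le_of_ne h1.2 ?_⟩, h6, h7⟩
  · rintro rfl
    rw [h.left.eq_lo] at h6
    rw [h.right.eq_lo] at h7
    exact lt_asymm h6 h7
  · rintro rfl
    rw [h.left.eq_hi] at h6
    rw [h.right.eq_hi] at h7
    exact lt_asymm h6 h7

theorem IsCell.isBounded {u w : Phat P} {l r : ℝ → ℝ} (h : H.IsCell u w l r) :
    Bornology.IsBounded (H.region u w l r) := by
  have hl := (isCompact_Icc (a := (H.pos u).2) (b := (H.pos w).2)).image_of_continuousOn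
    h.left.continuous.continuousOn
  have hr := (isCompact_Icc (a := (H.pos u).2) (b := (H.pos w).2)).image_of_continuousOn
    h.right.continuous.continuousOn
  obtain ⟨m, hm⟩ := hl.bddBelow
  obtain ⟨M, hM⟩ := hr.bddAbove
  refine ((Metric.isBounded_Icc m M).prod (Metric.isBounded_Icc (H.pos u).2 (H.pos w).2)).subset ?_
  intro z hz
  have h1 := hm (mem_image_of_mem l (Ioo_subset_Icc_self hz.1))
  have h2 := hM (mem_image_of_mem r (Ioo_subset_Icc_self hz.1))
  exact ⟨⟨h1.trans hz.2.1.le, hz.2.2.le.trans h2⟩, Ioo_subset_Icc_self hz.1⟩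

variable [Finite P]

/-- Two paths that meet away from the vertices agree locally. -/
theorem IsPath.exists_vertex_or_eventuallyEq {l r : ℝ → ℝ} (hl : H.IsPath l) (hr : H.IsPath r)
    {b : ℝ} (hb : b ∈ Icc (H.pos ⊥).2 (H.pos ⊤).2) (h : l b = r b) :
    (∃ v, H.pos v = (l b, b)) ∨ l =ᶠ[𝓝 b] r := by
  rcases H.exists_of_mem_drawing (hl.mem b hb) with hv | ⟨e, he, hee⟩
  · exact Or.inl hv
  · right
    filter_upwards [Ioo_mem_nhds he.1 he.2] with t ht
    have ht' := H.Ioo_subset_Icc_bot_top e ht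
    rw [H.eq_curve_of_eq_curve hl.continuous ordConnected_Icc hl.mem hb he hee.symm ht' ht,
      H.eq_curve_of_eq_curve hr.continuous ordConnected_Icc hr.mem hb he (h ▸ hee.symm) ht' ht]

variable (H)

/-- Since the paths form a finite lattice, there are a greatest path `l` to the left of `z` and a
least path `r` to the right of `z`. The cell lies between them, from the last meeting below `z` to
the first meeting above `z`. -/
theorem exists_isCell {z : ℝ × ℝ} (hz : z ∉ H.drawing) {x₁ x₂ : ℝ}
    (h₁ : (x₁, z.2) ∈ H.drawing) (h₂ : (x₂, z.2) ∈ H.drawing) (hx₁ : x₁ < z.1) (hx₂ : z.1 < x₂) :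
    ∃ u w l r, H.IsCell u w l r ∧ z ∈ H.region u w l r := by
  have hL : ∃ l, IsGreatest {γ | H.IsPath γ ∧ γ z.2 < z.1} l := by
    refine SupClosed.exists_isGreatest ?_ (H.finite_isPath.subset fun γ hγ => hγ.1) ?_
    · exact fun γ hγ δ hδ => ⟨hγ.1.sup hδ.1, max_lt hγ.2 hδ.2⟩
    · obtain ⟨γ, hγ, h⟩ := H.exists_path_of_mem_drawing h₁
      exact ⟨γ, hγ, h.trans_lt hx₁⟩
  have hR : ∃ r, IsLeast {γ | H.IsPath γ ∧ z.1 < γ z.2} r := by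
    refine InfClosed.exists_isLeast ?_ (H.finite_isPath.subset fun γ hγ => hγ.1) ?_
    · exact fun γ hγ δ hδ => ⟨hγ.1.inf hδ.1, lt_min hγ.2 hδ.2⟩
    · obtain ⟨γ, hγ, h⟩ := H.exists_path_of_mem_drawing h₂
      exact ⟨γ, hγ, hx₂.trans_eq h.symm⟩
  obtain ⟨l, ⟨hl, hlz⟩, hlmax⟩ := hL
  obtain ⟨r, ⟨hr, hzr⟩, hrmin⟩ := hR
  have hlr := hlz.trans hzr
  have hbot : (H.pos ⊥).2 < z.2 := by
    by_contra! hc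
    rw [hl.eq_bot _ hc, hr.eq_bot _ hc] at hlr
    exact lt_irrefl _ hlr
  have htop : z.2 < (H.pos ⊤).2 := by
    by_contra! hc
    rw [hl.eq_top _ hc, hr.eq_top _ hc] at hlr
    exact lt_irrefl _ hlr
  have hcl : IsClosed {t | r t ≤ l t} := isClosed_le hr.continuous hl.continuous
  obtain ⟨b, ⟨⟨hzb, hbt⟩, hb⟩, hbmin⟩ :=
    ((isCompact_Icc (a := z.2) (b := (H.pos ⊤).2)).inter_right hcl).exists_isLeast
      ⟨_, ⟨htop.le, le_rfl⟩, by simp [hl.eq_top, hr.eq_top]⟩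
  obtain ⟨a, ⟨⟨hba, haz⟩, ha⟩, hamax⟩ :=
    ((isCompact_Icc (a := (H.pos ⊥).2) (b := z.2)).inter_right hcl).exists_isGreatest
      ⟨_, ⟨le_rfl, hbot.le⟩, by simp [hl.eq_bot, hr.eq_bot]⟩
  rw [mem_ofPred_eq] at ha hb
  have hzb' : z.2 < b := lt_of_le_of_ne hzb (by rintro rfl; exact absurd hb hlr.not_ge)
  have haz' : a < z.2 := lt_of_le_of_ne haz (by rintro rfl; exact absurd ha hlr.not_ge)
  have hab : a < b := haz'.trans hzb'
  have hlt : ∀ t ∈ Ioo a b, l t < r t := by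
    intro t ht
    by_contra! hc
    rcases le_total z.2 t with h | h
    · exact absurd (hbmin ⟨⟨h, ht.2.le.trans hbt⟩, hc⟩) ht.2.not_ge
    · exact absurd (hamax ⟨⟨hba.trans ht.1.le, h⟩, hc⟩) ht.1.not_ge
  have hle : ∀ t ∈ Icc a b, l t ≤ r t := by
    intro t ht
    rw [← closure_Ioo hab.ne] at ht
    exact le_on_closure (fun s hs => (hlt s hs).le) hl.continuous.continuousOn
      hr.continuous.continuousOn ht
  have hb' : l b = r b := le_antisymm (hle b ⟨hab.le, le_rfl⟩) hb
  have ha' : l a = r a := le_antisymm (hle a ⟨le_rfl, hab.le⟩) ha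
  -- Away from a vertex the two paths would agree near `b`, but `l < r` holds just below `b`. The
  -- same argument applies just above `a`.
  obtain ⟨w, hw⟩ : ∃ w, H.pos w = (l b, b) := by
    rcases hl.exists_vertex_or_eventuallyEq hr ⟨hba.trans hab.le, hbt⟩ hb' with h | h
    · exact h
    · obtain ⟨t, ht, ht'⟩ := ((h.filter_mono nhdsWithin_le_nhds).and
        (Ioo_mem_nhdsLT hab)).exists
      exact absurd ht (hlt t ht').ne
  obtain ⟨u, hu⟩ : ∃ u, H.pos u = (l a, a) := by
    rcases hl.exists_vertex_or_eventuallyEq hr ⟨hba, hab.le.trans hbt⟩ ha' with h | h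
    · exact h
    · obtain ⟨t, ht, ht'⟩ := ((h.filter_mono nhdsWithin_le_nhds).and
        (Ioo_mem_nhdsGT hab)).exists
      exact absurd ht (hlt t ht').ne
  refine ⟨u, w, l, r, ⟨⟨?_, hl.continuous, ?_, ?_, ?_⟩, ⟨?_, hr.continuous, ?_, ?_, ?_⟩, ?_, ?_⟩,
    ⟨?_, hlz, hzr⟩⟩
  · simpa [hu, hw] using hab
  · exact fun t ht => hl.mem t (by simp only [hu, hw] at ht; exact ⟨hba.trans ht.1, ht.2.trans hbt⟩)
  · simp [hu]
  · simp [hw]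
  · simpa [hu, hw] using hab
  · exact fun t ht => hr.mem t (by simp only [hu, hw] at ht; exact ⟨hba.trans ht.1, ht.2.trans hbt⟩)
  · simp [hu, ha']
  · simp [hw, hb']
  · simpa [hu, hw] using hlt
  -- A point of the drawing inside the region lies on a path. At the height of `z` this path is left
  -- of `z`, hence nowhere right of `l`; or right of `z`, hence nowhere left of `r`; or it passes
  -- through `z`, which is not in the drawing.
  · rintro y ⟨-, hy1, hy2⟩ hyD
    obtain ⟨γ, hγ, hγy⟩ := H.exists_path_of_mem_drawing hyD
    rcases lt_trichotomy (γ z.2) z.1 with h | h | h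
    · exact absurd (hlmax ⟨hγ, h⟩ y.2) (by rw [hγy]; exact hy1.not_ge)
    · apply hz
      have : z = (γ z.2, z.2) := by rw [h]
      rw [this]
      exact hγ.mem _ ⟨hbot.le, htop.le⟩
    · exact absurd (hrmin ⟨hγ, h⟩ y.2) (by rw [hγy]; exact hy2.not_ge)
  · simpa [hu, hw] using ⟨haz', hzb'⟩

/-! ### The edges and the vertices on an arc -/

/-- The edges on the arc. -/
def arcEdges (u w : Phat P) (l : ℝ → ℝ) : Set (HEdge P) :=
  {e | H.midHeight e ∈ Ioo (H.pos u).2 (H.pos w).2 ∧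
    H.curve e (H.midHeight e) = l (H.midHeight e)}

/-- The vertices on the arc. -/
def arcVerts (u w : Phat P) (l : ℝ → ℝ) : Set (Phat P) :=
  {v | (H.pos v).2 ∈ Icc (H.pos u).2 (H.pos w).2 ∧ l (H.pos v).2 = (H.pos v).1}

namespace IsArc

variable {H} {u w : Phat P} {l : ℝ → ℝ} (h : H.IsArc u w l)
include h

/-- The arc follows the edge at all common heights. It cannot begin or end inside the edge, because
its ends are vertices and the interior of an edge contains none. -/
theorem subset_and_eqOn {e : HEdge P} {t : ℝ} (ht : t ∈ Ioo (H.pos u).2 (H.pos w).2)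
    (ht' : t ∈ Ioo (H.pos e.lo).2 (H.pos e.hi).2) (heq : H.curve e t = l t) :
    Icc (H.pos e.lo).2 (H.pos e.hi).2 ⊆ Icc (H.pos u).2 (H.pos w).2 ∧
      EqOn l (H.curve e) (Icc (H.pos e.lo).2 (H.pos e.hi).2) := by
  have key : ∀ s ∈ Icc (H.pos u).2 (H.pos w).2, s ∈ Ioo (H.pos e.lo).2 (H.pos e.hi).2 →
      l s = H.curve e s := fun s hs hs' =>
    H.eq_curve_of_eq_curve h.continuous ordConnected_Icc h.mem (Ioo_subset_Icc_self ht) ht'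
      heq.symm hs hs'
  have h1 : (H.pos u).2 ≤ (H.pos e.lo).2 := by
    by_contra! hc
    have := key _ ⟨le_rfl, h.height_lt.le⟩ ⟨hc, ht.1.trans ht'.2⟩
    exact H.curve_ne_pos e u ⟨hc, ht.1.trans ht'.2⟩ (by rw [← this, h.eq_lo])
  have h2 : (H.pos e.hi).2 ≤ (H.pos w).2 := by
    by_contra! hc
    have := key _ ⟨h.height_lt.le, le_rfl⟩ ⟨ht'.1.trans ht.2, hc⟩
    exact H.curve_ne_pos e w ⟨ht'.1.trans ht.2, hc⟩ (by rw [← this, h.eq_hi])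
  have hsub := Icc_subset_Icc h1 h2
  refine ⟨hsub, ?_⟩
  have hE : EqOn l (H.curve e) (Ioo (H.pos e.lo).2 (H.pos e.hi).2) :=
    fun s hs => key s (hsub (Ioo_subset_Icc_self hs)) hs
  exact hE.of_subset_closure h.continuous.continuousOn (H.curve_continuousOn e)
    Ioo_subset_Icc_self (closure_Ioo (H.height_lo_lt_hi e).ne).ge

theorem mem_arcEdges {e : HEdge P} {t : ℝ} (ht : t ∈ Ioo (H.pos u).2 (H.pos w).2)
    (ht' : t ∈ Ioo (H.pos e.lo).2 (H.pos e.hi).2) (heq : H.curve e t = l t) :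
    e ∈ H.arcEdges u w l := by
  obtain ⟨h1, h2⟩ := h.subset_and_eqOn ht ht' heq
  have hm := H.midHeight_mem e
  have hlo := h1 ⟨le_rfl, (H.height_lo_lt_hi e).le⟩
  have hhi := h1 ⟨(H.height_lo_lt_hi e).le, le_rfl⟩
  exact ⟨⟨hlo.1.trans_lt hm.1, hm.2.trans_le hhi.2⟩, (h2 (Ioo_subset_Icc_self hm)).symm⟩

theorem edge_subset {e : HEdge P} (he : e ∈ H.arcEdges u w l) :
    Icc (H.pos e.lo).2 (H.pos e.hi).2 ⊆ Icc (H.pos u).2 (H.pos w).2 :=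
  (h.subset_and_eqOn he.1 (H.midHeight_mem e) he.2).1

theorem edge_eqOn {e : HEdge P} (he : e ∈ H.arcEdges u w l) :
    EqOn l (H.curve e) (Icc (H.pos e.lo).2 (H.pos e.hi).2) :=
  (h.subset_and_eqOn he.1 (H.midHeight_mem e) he.2).2

theorem lo_mem {e : HEdge P} (he : e ∈ H.arcEdges u w l) : e.lo ∈ H.arcVerts u w l := by
  have hm : (H.pos e.lo).2 ∈ Icc (H.pos e.lo).2 (H.pos e.hi).2 :=
    ⟨le_rfl, (H.height_lo_lt_hi e).le⟩
  exact ⟨h.edge_subset he hm, by rw [h.edge_eqOn he hm, H.curve_lo]⟩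

theorem hi_mem {e : HEdge P} (he : e ∈ H.arcEdges u w l) : e.hi ∈ H.arcVerts u w l := by
  have hm : (H.pos e.hi).2 ∈ Icc (H.pos e.lo).2 (H.pos e.hi).2 :=
    ⟨(H.height_lo_lt_hi e).le, le_rfl⟩
  exact ⟨h.edge_subset he hm, by rw [h.edge_eqOn he hm, H.curve_hi]⟩

omit [Finite P] in
theorem bot_mem : u ∈ H.arcVerts u w l := ⟨⟨le_rfl, h.height_lt.le⟩, h.eq_lo⟩

omit [Finite P] in
theorem top_mem : w ∈ H.arcVerts u w l := ⟨⟨h.height_lt.le, le_rfl⟩, h.eq_hi⟩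

omit [Finite P] h in
theorem eq_of_height_eq {v v' : Phat P} (hv : v ∈ H.arcVerts u w l) (hv' : v' ∈ H.arcVerts u w l)
    (heq : (H.pos v).2 = (H.pos v').2) : v = v' :=
  H.pos_injective (Prod.ext (by rw [← hv.2, ← hv'.2, heq]) heq)

theorem height_notMem {e : HEdge P} (he : e ∈ H.arcEdges u w l) {v : Phat P}
    (hv : v ∈ H.arcVerts u w l) : (H.pos v).2 ∉ Ioo (H.pos e.lo).2 (H.pos e.hi).2 := fun hc =>
  H.curve_ne_pos e v hc (by rw [← h.edge_eqOn he (Ioo_subset_Icc_self hc), hv.2])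

theorem edge_eq_of_mem {e e' : HEdge P} (he : e ∈ H.arcEdges u w l)
    (he' : e' ∈ H.arcEdges u w l) {t : ℝ} (ht : t ∈ Ioo (H.pos e.lo).2 (H.pos e.hi).2)
    (ht' : t ∈ Ioo (H.pos e'.lo).2 (H.pos e'.hi).2) : e = e' := by
  by_contra hne
  exact H.curve_ne_curve e e' hne t ht ht' (by
    rw [← h.edge_eqOn he (Ioo_subset_Icc_self ht), h.edge_eqOn he' (Ioo_subset_Icc_self ht')])

theorem edge_eq_of_lo_eq {e e' : HEdge P} (he : e ∈ H.arcEdges u w l)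
    (he' : e' ∈ H.arcEdges u w l) (heq : e.lo = e'.lo) : e = e' := by
  have h1 := H.height_lo_lt_hi e
  have h2 := H.height_lo_lt_hi e'
  rw [← heq] at h2
  obtain ⟨t, ht1, ht2⟩ := exists_between (lt_min h1 h2)
  exact h.edge_eq_of_mem he he' ⟨ht1, ht2.trans_le (min_le_left _ _)⟩
    ⟨heq ▸ ht1, ht2.trans_le (min_le_right _ _)⟩

/-- Slightly above `v`, before the next vertex height, the arc is inside some edge. If this edge
began below `v`, then `v` would be in its interior; it cannot begin above `v`, since no vertex
height lies in between. -/
theorem exists_edge_lo_eq {v : Phat P} (hv : v ∈ H.arcVerts u w l) (hvw : v ≠ w) :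
    ∃ e ∈ H.arcEdges u w l, e.lo = v := by
  have hlt : (H.pos v).2 < (H.pos w).2 :=
    lt_of_le_of_ne hv.1.2 fun hc => hvw (eq_of_height_eq hv h.top_mem hc)
  have hev : ∀ᶠ t in 𝓝[>] (H.pos v).2, t ∈ Ioo (H.pos v).2 (H.pos w).2 ∧
      ∀ v', (H.pos v').2 ∉ Ioc (H.pos v).2 t := by
    refine Eventually.and (Ioo_mem_nhdsGT hlt) (eventually_all.2 fun v' => ?_)
    by_cases hv' : (H.pos v).2 < (H.pos v').2
    · filter_upwards [Ioo_mem_nhdsGT hv'] with t ht hc using ht.2.not_ge hc.2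
    · exact Eventually.of_forall fun t hc => hv' hc.1
  obtain ⟨t, ht, hno⟩ := hev.exists
  have htI : t ∈ Ioo (H.pos u).2 (H.pos w).2 := ⟨hv.1.1.trans_lt ht.1, ht.2⟩
  rcases H.exists_of_mem_drawing (h.mem t (Ioo_subset_Icc_self htI)) with ⟨v', hv'⟩ | ⟨e, he, hee⟩
  · exact absurd ⟨by rw [hv']; exact ht.1, by rw [hv']⟩ (hno v')
  · have hE := h.mem_arcEdges htI he hee
    refine ⟨e, hE, eq_of_height_eq (h.lo_mem hE) hv (le_antisymm ?_ ?_)⟩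
    · by_contra! hc
      exact hno e.lo ⟨hc, he.1.le⟩
    · by_contra! hc
      exact h.height_notMem hE hv ⟨hc, ht.1.trans he.2⟩

theorem exists_edge_hi_eq {v : Phat P} (hv : v ∈ H.arcVerts u w l) (hvu : v ≠ u) :
    ∃ e ∈ H.arcEdges u w l, e.hi = v := by
  have hlt : (H.pos u).2 < (H.pos v).2 :=
    lt_of_le_of_ne hv.1.1 fun hc => hvu (eq_of_height_eq h.bot_mem hv hc).symm
  have hev : ∀ᶠ t in 𝓝[<] (H.pos v).2, t ∈ Ioo (H.pos u).2 (H.pos v).2 ∧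
      ∀ v', (H.pos v').2 ∉ Ico t (H.pos v).2 := by
    refine Eventually.and (Ioo_mem_nhdsLT hlt) (eventually_all.2 fun v' => ?_)
    by_cases hv' : (H.pos v').2 < (H.pos v).2
    · filter_upwards [Ioo_mem_nhdsLT hv'] with t ht hc using ht.1.not_ge hc.1
    · exact Eventually.of_forall fun t hc => hv' hc.2
  obtain ⟨t, ht, hno⟩ := hev.exists
  have htI : t ∈ Ioo (H.pos u).2 (H.pos w).2 := ⟨ht.1, ht.2.trans_le hv.1.2⟩
  rcases H.exists_of_mem_drawing (h.mem t (Ioo_subset_Icc_self htI)) with ⟨v', hv'⟩ | ⟨e, he, hee⟩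
  · exact absurd ⟨by rw [hv'], by rw [hv']; exact ht.2⟩ (hno v')
  · have hE := h.mem_arcEdges htI he hee
    refine ⟨e, hE, eq_of_height_eq (h.hi_mem hE) hv (le_antisymm ?_ ?_)⟩
    · by_contra! hc
      exact h.height_notMem hE hv ⟨he.1.trans ht.2, hc⟩
    · by_contra! hc
      exact hno e.hi ⟨he.2.le, hc⟩

/-- Climbing from `v` along the edges of the arc cannot jump over `v'`. So the vertices of an arc
form a chain, ordered by height. -/
theorem le_of_height_le {v v' : Phat P} (hv : v ∈ H.arcVerts u w l)
    (hv' : v' ∈ H.arcVerts u w l) (hle : (H.pos v).2 ≤ (H.pos v').2) : v ≤ v' := by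
  induction v using WellFoundedGT.induction with
  | ind v ih =>
  rcases hle.eq_or_lt with heq | hlt
  · exact (eq_of_height_eq hv hv' heq).le
  · have hvw : v ≠ w := by
      rintro rfl
      exact hlt.not_ge hv'.1.2
    obtain ⟨e, he, rfl⟩ := h.exists_edge_lo_eq hv hvw
    refine e.lo_lt_hi.le.trans (ih e.hi e.lo_lt_hi (h.hi_mem he) ?_)
    by_contra! hc
    exact h.height_notMem he hv' ⟨hlt, hc⟩

theorem bot_le {v : Phat P} (hv : v ∈ H.arcVerts u w l) : u ≤ v :=
  h.le_of_height_le h.bot_mem hv hv.1.1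

theorem le_top {v : Phat P} (hv : v ∈ H.arcVerts u w l) : v ≤ w :=
  h.le_of_height_le hv h.top_mem hv.1.2

theorem lt_top : u < w :=
  lt_of_le_of_ne (h.bot_le h.top_mem) fun hc => h.height_lt.ne (by rw [hc])

/-- No vertex of the arc lies strictly between the endpoints of an edge of the arc. -/
theorem le_lo_or_hi_le {e : HEdge P} (he : e ∈ H.arcEdges u w l) {v : Phat P}
    (hv : v ∈ H.arcVerts u w l) : v ≤ e.lo ∨ e.hi ≤ v := by
  by_cases hc : (H.pos v).2 ≤ (H.pos e.lo).2
  · exact Or.inl (h.le_of_height_le hv (h.lo_mem he) hc)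
  · right
    refine h.le_of_height_le (h.hi_mem he) hv ?_
    by_contra! hc'
    exact h.height_notMem he hv ⟨not_le.1 hc, hc'⟩

/-- A sum of differences over the edges of the arc between two of its vertices telescopes. -/
theorem sum_eq_sub {T : Type*} {ι : T → HEdge P} (hι : Function.Injective ι)
    (hT : ∀ e ∈ H.arcEdges u w l, ∃ k, ι k = e) (g : Phat P → ℝ) {p q : Phat P}
    (hp : p ∈ H.arcVerts u w l) (hq : q ∈ H.arcVerts u w l) (hpq : p ≤ q) (s : Finset T)
    (hs : ∀ k, k ∈ s ↔ ι k ∈ H.arcEdges u w l ∧ p ≤ (ι k).lo ∧ (ι k).hi ≤ q) :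
    ∑ k ∈ s, (g (ι k).hi - g (ι k).lo) = g q - g p := by
  classical
  induction p using WellFoundedGT.induction generalizing s with
  | ind p ih =>
  rcases hpq.eq_or_lt with rfl | hlt
  · have : s = ∅ := Finset.eq_empty_of_forall_notMem fun k hk => by
      obtain ⟨-, h1, h2⟩ := (hs k).1 hk
      exact absurd (ι k).lo_lt_hi (h2.trans h1).not_gt
    simp [this]
  · obtain ⟨e, he, rfl⟩ := h.exists_edge_lo_eq hp (hlt.trans_le (h.le_top hq)).ne
    obtain ⟨k₀, rfl⟩ := hT _ he
    have hle : (ι k₀).hi ≤ q := (h.le_lo_or_hi_le he hq).resolve_left hlt.not_ge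
    have hk₀ : k₀ ∈ s := (hs k₀).2 ⟨he, le_rfl, hle⟩
    -- The edge that leaves `p` is split off; the remaining ones start at its upper endpoint or
    -- above.
    rw [← Finset.add_sum_erase s _ hk₀,
      ih _ (ι k₀).lo_lt_hi (h.hi_mem he) hle (s.erase k₀)]
    · ring
    intro k
    rw [Finset.mem_erase, hs]
    constructor
    · rintro ⟨hk, h1, h2, h3⟩
      refine ⟨h1, (h.le_lo_or_hi_le he (h.lo_mem h1)).resolve_left fun hc => hk ?_, h3⟩
      exact hι (h.edge_eq_of_lo_eq h1 he (le_antisymm hc h2))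
    · rintro ⟨h1, h2, h3⟩
      refine ⟨?_, h1, (ι k₀).lo_lt_hi.le.trans h2, h3⟩
      rintro rfl
      exact absurd (ι k).lo_lt_hi h2.not_gt

end IsArc

end BoundedEmbedding

theorem greatestOf_eq {Q : Type*} [PartialOrder Q] [OrderBot Q] {S : Set Q} {a : Q}
    (h : IsGreatest S a) : greatestOf S = a := by
  have hex : ∃ a, IsGreatest S a := ⟨a, h⟩
  rw [greatestOf, dif_pos hex]
  exact hex.choose_spec.unique h

theorem leastOf_eq {Q : Type*} [PartialOrder Q] [OrderBot Q] {S : Set Q} {a : Q}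
    (h : IsLeast S a) : leastOf S = a := by
  have hex : ∃ a, IsLeast S a := ⟨a, h⟩
  rw [leastOf, dif_pos hex]
  exact hex.choose_spec.unique h

/-! ### Cells as faces: their boundaries, minima and maxima -/

namespace BoundedEmbedding

variable {P : Type*} [PartialOrder P] {H : BoundedEmbedding P}

theorem IsCell.region_nonempty {u w : Phat P} {l r : ℝ → ℝ} (h : H.IsCell u w l r) :
    (H.region u w l r).Nonempty := by
  obtain ⟨t, ht⟩ := exists_between h.left.height_lt
  obtain ⟨x, hx⟩ := exists_between (h.lt t ht)
  exact ⟨(x, t), ht, hx⟩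

theorem IsCell.isBoundedFace {u w : Phat P} {l r : ℝ → ℝ} (h : H.IsCell u w l r) :
    H.IsBoundedFace (H.region u w l r) := by
  obtain ⟨z, hz⟩ := h.region_nonempty
  exact ⟨⟨z, h.notMem z hz, (h.connectedComponentIn_eq hz).symm⟩, h.isBounded⟩

/-- If the components of nearby points make up a cell, then the nearby points are in the cell. -/
theorem IsCell.eventually_mem_region {u w : Phat P} {l r : ℝ → ℝ} (h : H.IsCell u w l r)
    {p : ℝ → ℝ × ℝ}
    (heq : {z | ∀ᶠ ε in 𝓝[>] (0 : ℝ), z ∈ connectedComponentIn H.drawingᶜ (p ε)} =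
      H.region u w l r) : ∀ᶠ ε in 𝓝[>] (0 : ℝ), p ε ∈ H.region u w l r := by
  obtain ⟨z, hz⟩ := h.region_nonempty
  have hz' := hz
  rw [← heq] at hz'
  filter_upwards [show ∀ᶠ ε in 𝓝[>] (0 : ℝ), z ∈ connectedComponentIn H.drawingᶜ (p ε) from hz']
    with ε hε
  have h1 : p ε ∈ H.drawingᶜ := connectedComponentIn_nonempty_iff.1 ⟨z, hε⟩
  rw [← h.connectedComponentIn_eq hz, ← _root_.connectedComponentIn_eq hε]
  exact mem_connectedComponentIn h1

theorem IsCell.setOf_eventually_eq {u w : Phat P} {l r : ℝ → ℝ} (h : H.IsCell u w l r)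
    {p : ℝ → ℝ × ℝ} (hp : ∀ᶠ ε in 𝓝[>] (0 : ℝ), p ε ∈ H.region u w l r) :
    {z | ∀ᶠ ε in 𝓝[>] (0 : ℝ), z ∈ connectedComponentIn H.drawingᶜ (p ε)} =
      H.region u w l r := by
  ext z
  have : (∀ᶠ ε in 𝓝[>] (0 : ℝ), z ∈ connectedComponentIn H.drawingᶜ (p ε)) ↔
      ∀ᶠ ε in 𝓝[>] (0 : ℝ), z ∈ H.region u w l r :=
    eventually_congr (hp.mono fun ε hε => by rw [h.connectedComponentIn_eq hε])
  exact this.trans eventually_const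

/-- Points just to the right of the middle of `e` lie in the cell, so `l` is at most `e` there, by
`ε → 0`. If `e` were strictly to the right of `l`, it would run through the cell, which is free of
the drawing. -/
theorem IsCell.rightFace_eq_iff {u w : Phat P} {l r : ℝ → ℝ} (h : H.IsCell u w l r)
    {e : HEdge P} : H.rightFace e = H.region u w l r ↔ e ∈ H.arcEdges u w l := by
  have hm := H.midHeight_mem e
  constructor
  · intro heq
    have hev := h.eventually_mem_region heq
    obtain ⟨ε, hε, hε0⟩ := (hev.and self_mem_nhdsWithin).exists
    have hmem : H.midHeight e ∈ Ioo (H.pos u).2 (H.pos w).2 := hε.1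
    have hc : H.curve e (H.midHeight e) < r (H.midHeight e) :=
      (lt_add_of_pos_right _ hε0).trans hε.2.2
    refine ⟨hmem, le_antisymm ?_ ?_⟩
    · by_contra! hlt
      exact h.notMem (_, _) ⟨hmem, hlt, hc⟩ (H.curve_mem_drawing (Ioo_subset_Icc_self hm))
    · refine le_of_forall_pos_lt_add fun δ hδ => ?_
      obtain ⟨ε, hε, hε0⟩ := (hev.and (Ioo_mem_nhdsGT hδ)).exists
      exact hε.2.1.trans (by simpa using hε0.2)
  · rintro ⟨hmem, hc⟩
    refine h.setOf_eventually_eq ?_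
    filter_upwards [Ioo_mem_nhdsGT (sub_pos.2 (h.lt _ hmem))] with ε hε
    refine ⟨hmem, ?_, ?_⟩ <;> simp only [hc] <;> linarith [hε.1, hε.2]

theorem IsCell.leftFace_eq_iff {u w : Phat P} {l r : ℝ → ℝ} (h : H.IsCell u w l r)
    {e : HEdge P} : H.leftFace e = H.region u w l r ↔ e ∈ H.arcEdges u w r := by
  have hm := H.midHeight_mem e
  constructor
  · intro heq
    have hev := h.eventually_mem_region heq
    obtain ⟨ε, hε, hε0⟩ := (hev.and self_mem_nhdsWithin).exists
    have hmem : H.midHeight e ∈ Ioo (H.pos u).2 (H.pos w).2 := hε.1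
    have hc : l (H.midHeight e) < H.curve e (H.midHeight e) :=
      hε.2.1.trans (sub_lt_self _ hε0)
    refine ⟨hmem, le_antisymm ?_ ?_⟩
    · refine le_of_forall_pos_lt_add fun δ hδ => ?_
      obtain ⟨ε, hε, hε0⟩ := (hev.and (Ioo_mem_nhdsGT hδ)).exists
      have h1 := hε.2.2
      have h2 := hε0.2
      simp only at h1
      linarith
    · by_contra! hlt
      exact h.notMem (_, _) ⟨hmem, hc, hlt⟩ (H.curve_mem_drawing (Ioo_subset_Icc_self hm))
  · rintro ⟨hmem, hc⟩
    refine h.setOf_eventually_eq ?_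
    filter_upwards [Ioo_mem_nhdsGT (sub_pos.2 (h.lt _ hmem))] with ε hε
    refine ⟨hmem, ?_, ?_⟩ <;> simp only [hc] <;> linarith [hε.1, hε.2]

variable [Finite P]

theorem IsCell.leftBoundary_eq {u w : Phat P} {l r : ℝ → ℝ} (h : H.IsCell u w l r) :
    H.leftBoundary (H.region u w l r) = H.arcVerts u w l := by
  ext v
  constructor
  · rintro ⟨e, he, rfl | rfl⟩
    · exact h.left.lo_mem (h.rightFace_eq_iff.1 he)
    · exact h.left.hi_mem (h.rightFace_eq_iff.1 he)
  · intro hv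
    by_cases hvw : v = w
    · obtain ⟨e, he, hev⟩ := h.left.exists_edge_hi_eq hv (hvw ▸ h.left.lt_top.ne')
      exact ⟨e, h.rightFace_eq_iff.2 he, Or.inr hev.symm⟩
    · obtain ⟨e, he, hev⟩ := h.left.exists_edge_lo_eq hv hvw
      exact ⟨e, h.rightFace_eq_iff.2 he, Or.inl hev.symm⟩

theorem IsCell.mem_boundary {u w : Phat P} {l r : ℝ → ℝ} (h : H.IsCell u w l r) {v : Phat P}
    (hv : v ∈ H.arcVerts u w l) : v ∈ H.boundary (H.region u w l r) := by
  rw [← h.leftBoundary_eq] at hv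
  obtain ⟨e, he, hev⟩ := hv
  exact ⟨e, Or.inl he, hev⟩

theorem IsCell.le_of_mem_boundary {u w : Phat P} {l r : ℝ → ℝ} (h : H.IsCell u w l r)
    {v : Phat P} (hv : v ∈ H.boundary (H.region u w l r)) : u ≤ v ∧ v ≤ w := by
  obtain ⟨e, he | he, rfl | rfl⟩ := hv
  · have := h.left.lo_mem (h.rightFace_eq_iff.1 he)
    exact ⟨h.left.bot_le this, h.left.le_top this⟩
  · have := h.left.hi_mem (h.rightFace_eq_iff.1 he)
    exact ⟨h.left.bot_le this, h.left.le_top this⟩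
  · have := h.right.lo_mem (h.leftFace_eq_iff.1 he)
    exact ⟨h.right.bot_le this, h.right.le_top this⟩
  · have := h.right.hi_mem (h.leftFace_eq_iff.1 he)
    exact ⟨h.right.bot_le this, h.right.le_top this⟩

theorem IsCell.faceMin_eq {u w : Phat P} {l r : ℝ → ℝ} (h : H.IsCell u w l r) :
    H.faceMin (H.region u w l r) = u :=
  leastOf_eq ⟨h.mem_boundary h.left.bot_mem, fun _ hv => (h.le_of_mem_boundary hv).1⟩

theorem IsCell.faceMax_eq {u w : Phat P} {l r : ℝ → ℝ} (h : H.IsCell u w l r) :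
    H.faceMax (H.region u w l r) = w :=
  greatestOf_eq ⟨h.mem_boundary h.left.top_mem, fun _ hv => (h.le_of_mem_boundary hv).2⟩

/-! ### The two sides of an edge and the outer face -/

variable (H)

omit [Finite P] in
theorem curve_le_right (e : HEdge P) {t : ℝ} (ht : t ∈ Icc (H.pos e.lo).2 (H.pos e.hi).2) :
    H.curve e t ≤ H.curve .right t := by
  have hcl := closure_Ioo (H.height_lo_lt_hi e).ne
  rw [← hcl] at ht
  refine le_on_closure (fun s hs => ?_) (hcl ▸ H.curve_continuousOn e) (hcl ▸
    (H.curve_continuousOn .right).mono (Icc_subset_Icc (H.height_mono bot_le)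
      (H.height_mono le_top))) ht
  by_cases he : e = .right
  · rw [he]
  · exact (H.lt_right e he s hs).le

omit [Finite P] in
theorem left_le_curve (e : HEdge P) {t : ℝ} (ht : t ∈ Icc (H.pos e.lo).2 (H.pos e.hi).2) :
    H.curve .left t ≤ H.curve e t := by
  have hcl := closure_Ioo (H.height_lo_lt_hi e).ne
  rw [← hcl] at ht
  refine le_on_closure (fun s hs => ?_) (hcl ▸
    (H.curve_continuousOn .left).mono (Icc_subset_Icc (H.height_mono bot_le)
      (H.height_mono le_top))) (hcl ▸ H.curve_continuousOn e) ht
  by_cases he : e = .left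
  · rw [he]
  · exact (H.left_lt e he s hs).le

theorem not_isBounded_of_ray_subset {S : Set (ℝ × ℝ)} {c t : ℝ}
    (hS : ∀ x > c, (x, t) ∈ S) : ¬ Bornology.IsBounded S := by
  intro hb
  obtain ⟨C, hC⟩ := hb.exists_norm_le
  have h1 := (norm_fst_le _).trans (hC _ (hS (max (c + 1) (C + 1))
    (lt_max_of_lt_left (by linarith))))
  have h2 := (le_abs_self _).trans h1
  linarith [le_max_right (c + 1) (C + 1)]

theorem not_isBounded_of_ray_subset' {S : Set (ℝ × ℝ)} {c t : ℝ}
    (hS : ∀ x < c, (x, t) ∈ S) : ¬ Bornology.IsBounded S := by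
  intro hb
  obtain ⟨C, hC⟩ := hb.exists_norm_le
  have h1 := (norm_fst_le _).trans (hC _ (hS (min (c - 1) (-C - 1))
    (min_lt_of_left_lt (by linarith))))
  have h2 := (neg_le_abs _).trans h1
  linarith [min_le_right (c - 1) (-C - 1)]

/-- The horizontal ray that starts at the middle of the rightmost edge and goes to the right misses
the drawing, so it lies in a single component. -/
theorem not_isBounded_rightFace_right : ¬ Bornology.IsBounded (H.rightFace .right) := by
  set m := H.midHeight .right
  set c := H.curve .right m
  have hray : Ioi c ×ˢ {m} ⊆ H.drawingᶜ := by
    rintro ⟨x, t⟩ ⟨hx, rfl⟩ hD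
    obtain ⟨e, he, heq⟩ := H.exists_edge_of_mem_drawing hD
    have := H.curve_le_right e he
    simp only [heq] at this
    exact this.not_gt hx
  refine not_isBounded_of_ray_subset (c := c) (t := m) fun x hx => ?_
  change ∀ᶠ ε in 𝓝[>] (0 : ℝ), _
  filter_upwards [self_mem_nhdsWithin] with ε hε
  exact (isPreconnected_Ioi.prod isPreconnected_singleton).subset_connectedComponentIn
    (show (c + ε, m) ∈ Ioi c ×ˢ {m} from ⟨lt_add_of_pos_right c hε, rfl⟩) hray ⟨hx, rfl⟩

theorem not_isBounded_leftFace_left : ¬ Bornology.IsBounded (H.leftFace .left) := by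
  set m := H.midHeight .left
  set c := H.curve .left m
  have hray : Iio c ×ˢ {m} ⊆ H.drawingᶜ := by
    rintro ⟨x, t⟩ ⟨hx, rfl⟩ hD
    obtain ⟨e, he, heq⟩ := H.exists_edge_of_mem_drawing hD
    have := H.left_le_curve e he
    simp only [heq] at this
    exact this.not_gt hx
  refine not_isBounded_of_ray_subset' (c := c) (t := m) fun x hx => ?_
  change ∀ᶠ ε in 𝓝[>] (0 : ℝ), _
  filter_upwards [self_mem_nhdsWithin] with ε hε
  exact (isPreconnected_Iio.prod isPreconnected_singleton).subset_connectedComponentIn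
    (show (c - ε, m) ∈ Iio c ×ˢ {m} from ⟨sub_lt_self c hε, rfl⟩) hray ⟨hx, rfl⟩

theorem eventually_notMem_drawing (e : HEdge P) :
    ∀ᶠ x in 𝓝 (H.curve e (H.midHeight e)), x ≠ H.curve e (H.midHeight e) →
      (x, H.midHeight e) ∉ H.drawing := by
  have hc : Tendsto (fun x : ℝ => (x, H.midHeight e)) (𝓝 (H.curve e (H.midHeight e)))
      (𝓝 (H.curve e (H.midHeight e), H.midHeight e)) :=
    (Continuous.prodMk continuous_id continuous_const).tendsto _
  filter_upwards [hc.eventually (H.eventually_eq_curve e (H.midHeight_mem e))] with x hx hne hD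
  exact hne (hx hD)

/-- A point just to the right of the middle of `e` has `e` on its left and the rightmost edge on its
right, as `exists_isCell` requires. -/
theorem exists_isCell_right {e : HEdge P} (he : e ≠ .right) :
    ∃ u w l r, H.IsCell u w l r ∧ e ∈ H.arcEdges u w l := by
  have hm := H.midHeight_mem e
  have hlt := H.lt_right e he _ hm
  obtain ⟨δ, hδ, hsub⟩ := Metric.eventually_nhds_iff.1 (H.eventually_notMem_drawing e)
  obtain ⟨x, hx1, hx2⟩ := exists_between (lt_min hlt (lt_add_of_pos_right
    (H.curve e (H.midHeight e)) hδ))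
  -- The point `x` is within `δ` of `e`, so nothing is drawn between them. Hence the left arc of the
  -- cell of `x` has to pass through the middle of `e`.
  have hno : ∀ y, H.curve e (H.midHeight e) < y → y ≤ x → (y, H.midHeight e) ∉ H.drawing := by
    intro y hy hyx
    refine hsub ?_ hy.ne'
    rw [Real.dist_eq, abs_of_pos (sub_pos.2 hy)]
    linarith [min_le_right (H.curve .right (H.midHeight e)) (H.curve e (H.midHeight e) + δ)]
  obtain ⟨u, w, l, r, hcell, hz⟩ := H.exists_isCell (z := (x, H.midHeight e)) (hno x hx1 le_rfl)
    (H.curve_mem_drawing (Ioo_subset_Icc_self hm))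
    (H.curve_mem_drawing (e := .right) (H.Ioo_subset_Icc_bot_top e hm)) hx1
    (hx2.trans_le (min_le_left _ _))
  refine ⟨u, w, l, r, hcell, hz.1, le_antisymm ?_ ?_⟩
  · by_contra! hc
    exact hcell.notMem (H.curve e (H.midHeight e), H.midHeight e) ⟨hz.1, hc, hx1.trans hz.2.2⟩
      (H.curve_mem_drawing (Ioo_subset_Icc_self hm))
  · by_contra! hc
    exact hno _ hc hz.2.1.le (hcell.left.mem _ (Ioo_subset_Icc_self hz.1))

theorem exists_isCell_left {e : HEdge P} (he : e ≠ .left) :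
    ∃ u w l r, H.IsCell u w l r ∧ e ∈ H.arcEdges u w r := by
  have hm := H.midHeight_mem e
  have hlt := H.left_lt e he _ hm
  obtain ⟨δ, hδ, hsub⟩ := Metric.eventually_nhds_iff.1 (H.eventually_notMem_drawing e)
  obtain ⟨x, hx2, hx1⟩ := exists_between (max_lt hlt (sub_lt_self
    (H.curve e (H.midHeight e)) hδ))
  have hno : ∀ y, y < H.curve e (H.midHeight e) → x ≤ y → (y, H.midHeight e) ∉ H.drawing := by
    intro y hy hyx
    refine hsub ?_ hy.ne
    rw [Real.dist_eq, abs_of_neg (sub_neg.2 hy)]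
    linarith [le_max_right (H.curve .left (H.midHeight e)) (H.curve e (H.midHeight e) - δ)]
  obtain ⟨u, w, l, r, hcell, hz⟩ := H.exists_isCell (z := (x, H.midHeight e)) (hno x hx1 le_rfl)
    (H.curve_mem_drawing (e := .left) (H.Ioo_subset_Icc_bot_top e hm))
    (H.curve_mem_drawing (Ioo_subset_Icc_self hm))
    ((le_max_left _ _).trans_lt hx2) hx1
  refine ⟨u, w, l, r, hcell, hz.1, le_antisymm ?_ ?_⟩
  · by_contra! hc
    exact hno _ hc hz.2.2.le (hcell.right.mem _ (Ioo_subset_Icc_self hz.1))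
  · by_contra! hc
    exact hcell.notMem (H.curve e (H.midHeight e), H.midHeight e) ⟨hz.1, hz.2.1.trans hx1, hc⟩
      (H.curve_mem_drawing (Ioo_subset_Icc_self hm))

/-- The dual edge that crosses a cover relation. -/
def dualEdge (c : {c : Phat P × Phat P // c.1 ⋖ c.2}) : H.DualEdge :=
  ⟨.inl c, by
    obtain ⟨u, w, l, r, h, he⟩ := H.exists_isCell_right (e := .inl c) (by rintro ⟨⟩)
    rw [h.rightFace_eq_iff.2 he]
    exact h.isBounded, by
    obtain ⟨u, w, l, r, h, he⟩ := H.exists_isCell_left (e := .inl c) (by rintro ⟨⟩)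
    rw [h.leftFace_eq_iff.2 he]
    exact h.isBounded⟩

variable {H}

theorem DualEdge.ne_left (k : H.DualEdge) : k.1 ≠ .left := fun h =>
  H.not_isBounded_leftFace_left (h ▸ k.2.2)

theorem DualEdge.ne_right (k : H.DualEdge) : k.1 ≠ .right := fun h =>
  H.not_isBounded_rightFace_right (h ▸ k.2.1)

theorem exists_dualEdge {e : HEdge P} (h1 : e ≠ .left) (h2 : e ≠ .right) :
    ∃ k : H.DualEdge, k.1 = e := by
  rcases e with c | b
  · exact ⟨H.dualEdge c, rfl⟩
  · cases b
    · exact absurd rfl h1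
    · exact absurd rfl h2

/-- If an arc contains an edge that is crossed by a dual edge, then all of its edges are crossed
by dual edges. -/
theorem IsArc.exists_dualEdge {u w : Phat P} {l : ℝ → ℝ} (h : H.IsArc u w l) {k : H.DualEdge}
    (hk : k.1 ∈ H.arcEdges u w l) {e : HEdge P} (he : e ∈ H.arcEdges u w l) :
    ∃ k : H.DualEdge, k.1 = e := by
  have hm := H.midHeight_mem k.1
  have hm' := H.Ioo_subset_Icc_bot_top k.1 hm
  -- The additional edges span all heights, and an arc has only one edge at a given interior height.
  -- So an arc with an additional edge contains no other edge.
  have hm'' : H.midHeight k.1 ∈ Ioo (H.pos ⊥).2 (H.pos ⊤).2 :=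
    ⟨(H.height_mono _root_.bot_le).trans_lt hm.1, hm.2.trans_le (H.height_mono _root_.le_top)⟩
  refine BoundedEmbedding.exists_dualEdge ?_ ?_
  · rintro rfl
    exact k.ne_left (h.edge_eq_of_mem hk he hm hm'')
  · rintro rfl
    exact k.ne_right (h.edge_eq_of_mem hk he hm hm'')

end BoundedEmbedding

/-! ### Extension of points of the order polytope by the extreme markings -/

namespace MarkedPoset

variable {P : Type*} [PartialOrder P] (M : MarkedPoset P)

theorem isMarked_bot : M.IsMarked ⊥ := Or.inl rfl

theorem isMarked_top : M.IsMarked ⊤ := Or.inr (Or.inl rfl)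

open Classical in
theorem extend_eq_mark {x : P → ℝ} (hx : ∀ a : M.A, x a = M.lam a) {v : Phat P}
    (hv : M.IsMarked v) : M.extend x v = M.mark v := by
  rcases hv with rfl | rfl | ⟨a, ha, rfl⟩
  · rfl
  · rfl
  · change x a = if h : a ∈ M.A then M.lam ⟨a, h⟩ else 0
    rw [dif_pos ha]
    exact hx ⟨a, ha⟩

theorem exists_mem_le [Finite P] (p : P) : ∃ a ∈ M.A, a ≤ p := by
  obtain ⟨a, hap, ha⟩ := exists_minimal_le_of_wellFoundedLT (fun _ : P => True) p trivial
  exact ⟨a, M.extremal_mem a (Or.inl fun b hb => ha.2 trivial hb), hap⟩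

theorem exists_mem_ge [Finite P] (p : P) : ∃ a ∈ M.A, p ≤ a := by
  obtain ⟨a, hap, ha⟩ := exists_maximal_ge_of_wellFoundedGT (fun _ : P => True) p trivial
  exact ⟨a, M.extremal_mem a (Or.inr fun b hb => ha.2 trivial hb), hap⟩

theorem nonempty_marked [Finite P] [Nonempty P] : Nonempty M.A := by
  obtain ⟨a, ha, -⟩ := M.exists_mem_le (Classical.arbitrary P)
  exact ⟨⟨a, ha⟩⟩

theorem bot_le_lam [Finite P] (a : M.A) : ⨅ a : M.A, M.lam a ≤ M.lam a :=
  ciInf_le (finite_range _).bddBelow a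

theorem lam_le_top [Finite P] (a : M.A) : M.lam a ≤ ⨆ a : M.A, M.lam a :=
  le_ciSup (finite_range _).bddAbove a

open Classical in
theorem mem_orderPolytope_of_monotone {x : P → ℝ} (hx : Monotone (M.extend x))
    (ha : ∀ v, M.IsMarked v → M.extend x v = M.mark v) : x ∈ M.orderPolytope := by
  refine ⟨fun p q hpq => hx (WithBot.coe_le_coe.2 (WithTop.coe_le_coe.2 hpq.le)), fun a => ?_⟩
  have h1 : M.extend x (((a : P) : WithTop P) : Phat P) = _ :=
    ha _ (Or.inr (Or.inr ⟨a, a.2, rfl⟩))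
  change x a = if h : (a : P) ∈ M.A then M.lam ⟨a, h⟩ else 0 at h1
  rw [h1, dif_pos a.2]

/-- Every element lies between a minimal and a maximal one. These are marked, so its value lies
between the smallest and the largest marking. -/
theorem monotone_extend [Finite P] [Nonempty P] {x : P → ℝ} (hx : x ∈ M.orderPolytope) :
    Monotone (M.extend x) := by
  have hmono : ∀ p q : P, p ≤ q → x p ≤ x q := fun p q h => by
    rcases h.eq_or_lt with rfl | h
    · exact le_rfl
    · exact hx.1 p q h
  have hbot : ∀ p : P, M.extend x ⊥ ≤ x p := fun p => by
    obtain ⟨a, ha, hap⟩ := M.exists_mem_le p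
    exact (M.bot_le_lam ⟨a, ha⟩).trans ((hx.2 ⟨a, ha⟩).symm.le.trans (hmono a p hap))
  have htop : ∀ p : P, x p ≤ M.extend x ⊤ := fun p => by
    obtain ⟨a, ha, hap⟩ := M.exists_mem_ge p
    exact ((hmono p a hap).trans (hx.2 ⟨a, ha⟩).le).trans (M.lam_le_top ⟨a, ha⟩)
  intro v v' h
  induction v using WithBot.recBotCoe with
  | bot =>
    induction v' using WithBot.recBotCoe with
    | bot => exact le_rfl
    | coe v' =>
      induction v' using WithTop.recTopCoe with
      | top => exact (hbot (Classical.arbitrary P)).trans (htop _)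
      | coe q => exact hbot q
  | coe v =>
    induction v' using WithBot.recBotCoe with
    | bot => exact absurd h (WithBot.bot_lt_coe v).not_ge
    | coe v' =>
      rw [WithBot.coe_le_coe] at h
      induction v' using WithTop.recTopCoe with
      | top =>
        induction v using WithTop.recTopCoe with
        | top => exact le_rfl
        | coe p => exact htop p
      | coe q =>
        induction v using WithTop.recTopCoe with
        | top => exact absurd h (WithTop.coe_lt_top q).not_ge
        | coe p => exact hmono p q (WithTop.coe_le_coe.1 h)

end MarkedPoset

/-! ### Network vertices in terms of cells, and the flow of a potential -/

namespace BoundedEmbedding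

variable {P : Type*} [PartialOrder P] {H : BoundedEmbedding P} (M : MarkedPoset P)

theorem srcLabel_of_leftMarked {k : H.DualEdge} (h : H.LeftMarked M (H.rightFace k.1)) :
    H.srcLabel M k = .source (H.rightFace k.1)
      (leastOf {v | v ∈ H.leftBoundary (H.rightFace k.1) ∧ M.IsMarked v ∧ k.1.hi ≤ v})
      (greatestOf {v | v ∈ H.leftBoundary (H.rightFace k.1) ∧ M.IsMarked v ∧ v ≤ k.1.lo}) :=
  if_pos h

theorem srcLabel_of_not_leftMarked {k : H.DualEdge} (h : ¬ H.LeftMarked M (H.rightFace k.1)) :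
    H.srcLabel M k = .face (H.rightFace k.1) :=
  if_neg h

variable {M} in
theorem srcLabel_eq_face_iff {k : H.DualEdge} {F : Set (ℝ × ℝ)} :
    H.srcLabel M k = .face F ↔ H.rightFace k.1 = F ∧ ¬ H.LeftMarked M F := by
  by_cases h : H.LeftMarked M (H.rightFace k.1)
  · rw [srcLabel_of_leftMarked M h]
    simp only [reduceCtorEq, false_iff, not_and, not_not]
    rintro rfl
    exact h
  · rw [srcLabel_of_not_leftMarked M h]
    simp only [VertexLabel.face.injEq]
    constructor
    · rintro rfl
      exact ⟨rfl, h⟩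
    · exact fun h => h.1

theorem tgtLabel_eq_face_iff {k : H.DualEdge} {F : Set (ℝ × ℝ)} :
    H.tgtLabel k = .face F ↔ H.leftFace k.1 = F := by
  simp [tgtLabel]

variable [Finite P]

variable (H) in
open Classical in
/-- The dual edges that cross the edges of an arc. -/
def arcDuals (u w : Phat P) (l : ℝ → ℝ) : Finset H.DualEdge :=
  Finset.univ.filter fun k => k.1 ∈ H.arcEdges u w l

theorem mem_arcDuals {u w : Phat P} {l : ℝ → ℝ} {k : H.DualEdge} :
    k ∈ H.arcDuals u w l ↔ k.1 ∈ H.arcEdges u w l := by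
  simp [arcDuals]

/-- This is the description of the summation set that `IsArc.sum_eq_sub` expects when the sum runs
over the whole arc. -/
theorem IsArc.mem_arcDuals_iff {u w : Phat P} {l : ℝ → ℝ} (h : H.IsArc u w l) {k : H.DualEdge} :
    k ∈ H.arcDuals u w l ↔ k.1 ∈ H.arcEdges u w l ∧ u ≤ k.1.lo ∧ k.1.hi ≤ w := by
  rw [mem_arcDuals]
  exact ⟨fun hk => ⟨hk, h.bot_le (h.lo_mem hk), h.le_top (h.hi_mem hk)⟩, fun hk => hk.1⟩

theorem IsArc.exists_isLeast {u w : Phat P} {l : ℝ → ℝ} (h : H.IsArc u w l) {T : Set (Phat P)}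
    (hT : T ⊆ H.arcVerts u w l) (hne : T.Nonempty) : ∃ b, IsLeast T b := by
  obtain ⟨b, hb, hmin⟩ := exists_min_image T (fun v => (H.pos v).2) (toFinite _) hne
  exact ⟨b, hb, fun v hv => h.le_of_height_le (hT hb) (hT hv) (hmin v hv)⟩

theorem IsArc.exists_isGreatest {u w : Phat P} {l : ℝ → ℝ} (h : H.IsArc u w l)
    {T : Set (Phat P)} (hT : T ⊆ H.arcVerts u w l) (hne : T.Nonempty) : ∃ b, IsGreatest T b := by
  obtain ⟨b, hb, hmax⟩ := exists_max_image T (fun v => (H.pos v).2) (toFinite _) hne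
  exact ⟨b, hb, fun v hv => h.le_of_height_le (hT hv) (hT hb) (hmax v hv)⟩

theorem IsArc.edge_eq_of_hi_eq {u w : Phat P} {l : ℝ → ℝ} (h : H.IsArc u w l) {e e' : HEdge P}
    (he : e ∈ H.arcEdges u w l) (he' : e' ∈ H.arcEdges u w l) (heq : e.hi = e'.hi) : e = e' := by
  have h1 := H.height_lo_lt_hi e
  have h2 := H.height_lo_lt_hi e'
  rw [← heq] at h2
  obtain ⟨t, ht1, ht2⟩ := exists_between (max_lt h1 h2)
  exact h.edge_eq_of_mem he he' ⟨(le_max_left _ _).trans_lt ht1, ht2⟩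
    ⟨(le_max_right _ _).trans_lt ht1, heq ▸ ht2⟩

namespace IsCell

variable {M} {u w : Phat P} {l r : ℝ → ℝ} (h : H.IsCell u w l r)
include h

theorem leftMarked_iff :
    H.LeftMarked M (H.region u w l r) ↔ ∃ v ∈ H.arcVerts u w l, M.IsMarked v := by
  rw [LeftMarked, h.leftBoundary_eq]

theorem isMarked_of_leftMarked (hH : H.IsBoundedStronglyPlanar M)
    (hM : H.LeftMarked M (H.region u w l r)) : M.IsMarked u ∧ M.IsMarked w := by
  have := hH _ h.isBoundedFace hM
  rwa [h.faceMin_eq, h.faceMax_eq] at this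

/-- The marked elements `a < b` of the left boundary are consecutive: the edge `k` lies between
them, and no marked element does. -/
theorem srcLabel_eq_iff (hM : H.LeftMarked M (H.region u w l r))
    (hm : M.IsMarked u ∧ M.IsMarked w) {k : H.DualEdge}
    (hk : k.1 ∈ H.arcEdges u w l) {a b : Phat P}
    (hb : IsLeast {v | v ∈ H.arcVerts u w l ∧ M.IsMarked v ∧ k.1.hi ≤ v} b)
    (ha : IsGreatest {v | v ∈ H.arcVerts u w l ∧ M.IsMarked v ∧ v ≤ k.1.lo} a)
    {k' : H.DualEdge} : H.srcLabel M k' = .source (H.region u w l r) b a ↔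
      k'.1 ∈ H.arcEdges u w l ∧ a ≤ k'.1.lo ∧ k'.1.hi ≤ b := by
  have hlab : ∀ {j : H.DualEdge}, j.1 ∈ H.arcEdges u w l → H.srcLabel M j =
      .source (H.region u w l r)
        (leastOf {v | v ∈ H.arcVerts u w l ∧ M.IsMarked v ∧ j.1.hi ≤ v})
        (greatestOf {v | v ∈ H.arcVerts u w l ∧ M.IsMarked v ∧ v ≤ j.1.lo}) := by
    intro j hj
    have hF := h.rightFace_eq_iff.2 hj
    rw [srcLabel_of_leftMarked M (hF.symm ▸ hM), hF, h.leftBoundary_eq]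
  constructor
  · intro heq
    have hk' : k'.1 ∈ H.arcEdges u w l := by
      by_cases hM' : H.LeftMarked M (H.rightFace k'.1)
      · rw [srcLabel_of_leftMarked M hM'] at heq
        injection heq with h1
        exact h.rightFace_eq_iff.1 h1
      · rw [srcLabel_of_not_leftMarked M hM'] at heq
        cases heq
    obtain ⟨b', hb'⟩ := h.left.exists_isLeast
      (T := {v | v ∈ H.arcVerts u w l ∧ M.IsMarked v ∧ k'.1.hi ≤ v}) (fun v hv => hv.1)
      ⟨w, h.left.top_mem, hm.2, h.left.le_top (h.left.hi_mem hk')⟩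
    obtain ⟨a', ha'⟩ := h.left.exists_isGreatest
      (T := {v | v ∈ H.arcVerts u w l ∧ M.IsMarked v ∧ v ≤ k'.1.lo}) (fun v hv => hv.1)
      ⟨u, h.left.bot_mem, hm.1, h.left.bot_le (h.left.lo_mem hk')⟩
    rw [hlab hk', leastOf_eq hb', greatestOf_eq ha'] at heq
    injection heq with _ h2 h3
    subst h2 h3
    exact ⟨hk', ha'.1.2.2, hb'.1.2.2⟩
  · rintro ⟨hk', h1, h2⟩
    rw [hlab hk', leastOf_eq (a := b), greatestOf_eq (a := a)]
    · refine ⟨⟨ha.1.1, ha.1.2.1, h1⟩, fun v ⟨hv, hvm, hvl⟩ => ha.2 ⟨hv, hvm, ?_⟩⟩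
      -- If `v` were above the edge `k`, then `b ≤ v ≤ k'.1.lo < k'.1.hi ≤ b`.
      refine (h.left.le_lo_or_hi_le hk hv).resolve_right fun hc => ?_
      exact ((hb.2 ⟨hv, hvm, hc⟩).trans hvl).not_gt (k'.1.lo_lt_hi.trans_le h2)
    · refine ⟨⟨hb.1.1, hb.1.2.1, h2⟩, fun v ⟨hv, hvm, hvl⟩ => hb.2 ⟨hv, hvm, ?_⟩⟩
      refine (h.left.le_lo_or_hi_le hk hv).resolve_left fun hc => ?_
      exact (hvl.trans (ha.2 ⟨hv, hvm, hc⟩)).not_gt (h1.trans_lt k'.1.lo_lt_hi)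

/-- If the left boundary has no marked element, then the face is not next to one of the two
additional edges. -/
theorem ne_of_not_leftMarked (hM : ¬ H.LeftMarked M (H.region u w l r)) {e : HEdge P}
    (he : e ∈ H.arcEdges u w l ∨ e ∈ H.arcEdges u w r) : e ≠ .left ∧ e ≠ .right := by
  -- Both additional edges start at `⊥`, which is marked.
  have hu : u ≠ ⊥ := fun hc => hM (h.leftMarked_iff.2 ⟨u, h.left.bot_mem, hc ▸ M.isMarked_bot⟩)
  have hle : u ≤ e.lo := he.elim (fun he => h.left.bot_le (h.left.lo_mem he))
    fun he => h.right.bot_le (h.right.lo_mem he)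
  constructor <;>
  · rintro rfl
    exact hu (le_bot_iff.1 hle)

theorem filter_tgtLabel_eq [DecidablePred fun k : H.DualEdge =>
    H.tgtLabel k = .face (H.region u w l r)] :
    (Finset.univ.filter fun k : H.DualEdge => H.tgtLabel k = .face (H.region u w l r)) =
      H.arcDuals u w r := by
  ext k
  rw [mem_arcDuals, Finset.mem_filter, tgtLabel_eq_face_iff, h.leftFace_eq_iff]
  simp

theorem filter_srcLabel_eq (hM : ¬ H.LeftMarked M (H.region u w l r))
    [DecidablePred fun k : H.DualEdge => H.srcLabel M k = .face (H.region u w l r)] :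
    (Finset.univ.filter fun k : H.DualEdge => H.srcLabel M k = .face (H.region u w l r)) =
      H.arcDuals u w l := by
  ext k
  rw [mem_arcDuals, Finset.mem_filter, srcLabel_eq_face_iff, h.rightFace_eq_iff]
  simp [hM]

omit h in
theorem filter_srcLabel_eq_empty (hM : H.LeftMarked M (H.region u w l r))
    [DecidablePred fun k : H.DualEdge => H.srcLabel M k = .face (H.region u w l r)] :
    (Finset.univ.filter fun k : H.DualEdge => H.srcLabel M k = .face (H.region u w l r)) = ∅ := by
  ext k
  rw [Finset.mem_filter, srcLabel_eq_face_iff]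
  simp [hM]

theorem netflowLabel_of_leftMarked (hM : H.LeftMarked M (H.region u w l r)) :
    H.netflowLabel M (.face (H.region u w l r)) = -(M.mark w - M.mark u) := by
  simp only [netflowLabel, if_pos hM, h.faceMin_eq, h.faceMax_eq]

omit [Finite P] h in
theorem netflowLabel_of_not_leftMarked (hM : ¬ H.LeftMarked M (H.region u w l r)) :
    H.netflowLabel M (.face (H.region u w l r)) = 0 := by
  simp only [netflowLabel, if_neg hM]

end IsCell

open Classical in
variable (H) in
theorem mem_flowPolytope_iff {f : H.DualEdge → ℝ} :
    f ∈ (H.network M).flowPolytope ↔ (∀ k, 0 ≤ f k) ∧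
      ∀ v, (∃ k : H.DualEdge, H.srcLabel M k = v ∨ H.tgtLabel k = v) →
        (∑ k with H.srcLabel M k = v, f k) - (∑ k with H.tgtLabel k = v, f k) =
          H.netflowLabel M v := by
  have hs : ∀ (v : H.Vertex M) k, (H.network M).src k = v ↔ H.srcLabel M k = v.1 :=
    fun v k => Subtype.ext_iff
  have ht : ∀ (v : H.Vertex M) k, (H.network M).tgt k = v ↔ H.tgtLabel k = v.1 :=
    fun v k => Subtype.ext_iff
  simp only [FlowNetwork.flowPolytope]
  change _ ∧ (∀ v, _) ↔ _
  simp only [hs, ht]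
  exact and_congr_right fun _ => ⟨fun h v hv => h ⟨v, hv⟩, fun h v => h v.1 v.2⟩

open Classical in
theorem filter_tgtLabel_source_eq_empty (F : Set (ℝ × ℝ)) (b a : Phat P) :
    (Finset.univ.filter fun k : H.DualEdge => H.tgtLabel k = .source F b a) = ∅ := by
  ext k
  simp [tgtLabel]

variable {M}

/-- The next marked elements of the left boundary above and below an edge of it. -/
theorem IsCell.exists_next_marked {u w : Phat P} {l r : ℝ → ℝ} (h : H.IsCell u w l r)
    (hm : M.IsMarked u ∧ M.IsMarked w) {e : HEdge P} (he : e ∈ H.arcEdges u w l) :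
    (∃ b, IsLeast {v | v ∈ H.arcVerts u w l ∧ M.IsMarked v ∧ e.hi ≤ v} b) ∧
      ∃ a, IsGreatest {v | v ∈ H.arcVerts u w l ∧ M.IsMarked v ∧ v ≤ e.lo} a :=
  ⟨h.left.exists_isLeast (fun _ hv => hv.1)
    ⟨w, h.left.top_mem, hm.2, h.left.le_top (h.left.hi_mem he)⟩,
  h.left.exists_isGreatest (fun _ hv => hv.1)
    ⟨u, h.left.bot_mem, hm.1, h.left.bot_le (h.left.lo_mem he)⟩⟩

/-- The differences of a monotone function that extends the marking form a flow. -/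
theorem sub_mem_flowPolytope (hH : H.IsBoundedStronglyPlanar M) {g : Phat P → ℝ}
    (hg : Monotone g) (hgM : ∀ v, M.IsMarked v → g v = M.mark v) :
    (fun k : H.DualEdge => g k.1.hi - g k.1.lo) ∈ (H.network M).flowPolytope := by
  classical
  rw [mem_flowPolytope_iff]
  refine ⟨fun k => sub_nonneg.2 (hg k.1.lo_lt_hi.le), ?_⟩
  have harc : ∀ {u w : Phat P} {l : ℝ → ℝ}, H.IsArc u w l →
      (∀ e ∈ H.arcEdges u w l, ∃ k : H.DualEdge, k.1 = e) →
      ∑ k ∈ H.arcDuals u w l, (g k.1.hi - g k.1.lo) = g w - g u := fun h hd =>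
    h.sum_eq_sub (ι := fun k : H.DualEdge => k.1) Subtype.val_injective hd g h.bot_mem
      h.top_mem h.lt_top.le _ fun k => h.mem_arcDuals_iff
  -- For a marked face the balance at `v_F` needs a dual edge across the right boundary. It may fail
  -- at the rightmost face, where no edge enters and the label is not a vertex of the network.
  have hface : ∀ {u w : Phat P} {l r : ℝ → ℝ}, H.IsCell u w l r →
      (¬ H.LeftMarked M (H.region u w l r) ∨ ∃ k : H.DualEdge, k.1 ∈ H.arcEdges u w r) →
      (∑ k with H.srcLabel M k = .face (H.region u w l r), (g k.1.hi - g k.1.lo)) -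
        (∑ k with H.tgtLabel k = .face (H.region u w l r), (g k.1.hi - g k.1.lo)) =
        H.netflowLabel M (.face (H.region u w l r)) := by
    intro u w l r h hk
    rw [h.filter_tgtLabel_eq]
    by_cases hM : H.LeftMarked M (H.region u w l r)
    · obtain ⟨k, hk⟩ := hk.resolve_left (not_not.2 hM)
      obtain ⟨hu, hw⟩ := h.isMarked_of_leftMarked hH hM
      rw [IsCell.filter_srcLabel_eq_empty hM, h.netflowLabel_of_leftMarked hM,
        harc h.right fun e he => h.right.exists_dualEdge hk he, hgM u hu, hgM w hw]
      simp
    · rw [h.filter_srcLabel_eq hM, IsCell.netflowLabel_of_not_leftMarked hM,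
        harc h.left fun e he => ?_, harc h.right fun e he => ?_, sub_self]
      · exact exists_dualEdge (h.ne_of_not_leftMarked hM (Or.inr he)).1
          (h.ne_of_not_leftMarked hM (Or.inr he)).2
      · exact exists_dualEdge (h.ne_of_not_leftMarked hM (Or.inl he)).1
          (h.ne_of_not_leftMarked hM (Or.inl he)).2
  rintro _ ⟨k, rfl | rfl⟩
  · obtain ⟨u, w, l, r, h, hk⟩ := H.exists_isCell_right k.ne_right
    have hF := h.rightFace_eq_iff.2 hk
    by_cases hM : H.LeftMarked M (H.region u w l r)
    · have hm := h.isMarked_of_leftMarked hH hM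
      obtain ⟨⟨b, hb⟩, a, ha⟩ := h.exists_next_marked hm hk
      rw [(h.srcLabel_eq_iff hM hm hk hb ha).2 ⟨hk, ha.1.2.2, hb.1.2.2⟩,
        filter_tgtLabel_source_eq_empty, Finset.sum_empty, sub_zero,
        h.left.sum_eq_sub (ι := fun k : H.DualEdge => k.1) Subtype.val_injective
          (fun e he => h.left.exists_dualEdge hk he) g ha.1.1 hb.1.1
          ((ha.1.2.2.trans k.1.lo_lt_hi.le).trans hb.1.2.2), hgM a ha.1.2.1, hgM b hb.1.2.1]
      · rfl
      · intro k'
        simp [h.srcLabel_eq_iff hM hm hk hb ha]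
    · rw [srcLabel_of_not_leftMarked M (hF ▸ hM), hF]
      exact hface h (Or.inl hM)
  · obtain ⟨u, w, l, r, h, hk⟩ := H.exists_isCell_left k.ne_left
    rw [tgtLabel, h.leftFace_eq_iff.2 hk]
    exact hface h (Or.inr ⟨k, hk⟩)

/-! ### Sums of a flow over the boundaries of a face -/

section Flow

variable {f : H.DualEdge → ℝ} {u w : Phat P} {l r : ℝ → ℝ}

/-- In a flow, the flow across the part of the left boundary below a marked element. -/
theorem IsCell.sum_left_eq (h : H.IsCell u w l r) (hH : H.IsBoundedStronglyPlanar M)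
    (hf : f ∈ (H.network M).flowPolytope) (hM : H.LeftMarked M (H.region u w l r))
    {k₀ : H.DualEdge} (hk₀ : k₀.1 ∈ H.arcEdges u w l) {p : Phat P} (hp : p ∈ H.arcVerts u w l)
    (hpM : M.IsMarked p) {s : Finset H.DualEdge}
    (hs : ∀ k, k ∈ s ↔ k.1 ∈ H.arcEdges u w l ∧ k.1.hi ≤ p) :
    ∑ k ∈ s, f k = M.mark p - M.mark u := by
  classical
  have hm := h.isMarked_of_leftMarked hH hM
  induction p using WellFoundedLT.induction generalizing s with
  | ind p ih =>
  by_cases hpu : p = u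
  · subst hpu
    have : s = ∅ := Finset.eq_empty_of_forall_notMem fun k hk => by
      obtain ⟨h1, h2⟩ := (hs k).1 hk
      exact absurd (h.left.bot_le (h.left.lo_mem h1)) (k.1.lo_lt_hi.trans_le h2).not_ge
    simp [this]
  -- Let `a` be the next marked element below `p`. The source between them accounts for the edges
  -- from `a` to `p`, and the induction hypothesis at `a` for those below.
  · obtain ⟨e, he, hep⟩ := h.left.exists_edge_hi_eq hp hpu
    obtain ⟨k, rfl⟩ := h.left.exists_dualEdge hk₀ he
    obtain ⟨-, a, ha⟩ := h.exists_next_marked hm he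
    have hb : IsLeast {v | v ∈ H.arcVerts u w l ∧ M.IsMarked v ∧ k.1.hi ≤ v} p :=
      ⟨⟨hp, hpM, hep.le⟩, fun v hv => hep ▸ hv.2.2⟩
    have hap : a < p := ha.1.2.2.trans_lt (hep ▸ k.1.lo_lt_hi)
    have hnet := ((mem_flowPolytope_iff H M).1 hf).2 _
      ⟨k, Or.inl ((h.srcLabel_eq_iff hM hm he hb ha).2 ⟨he, ha.1.2.2, hep.le⟩)⟩
    rw [filter_tgtLabel_source_eq_empty, Finset.sum_empty, sub_zero] at hnet
    simp only [netflowLabel] at hnet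
    have hih := ih a hap ha.1.1 ha.1.2.1 (s := s.filter fun k => k.1.hi ≤ a) (fun k' => by
      rw [Finset.mem_filter, hs]
      exact ⟨fun hh => ⟨hh.1.1, hh.2⟩, fun hh => ⟨⟨hh.1, hh.2.trans hap.le⟩, hh.2⟩⟩)
    rw [← Finset.sum_filter_add_sum_filter_not s (fun k => k.1.hi ≤ a), hih]
    have hset : (s.filter fun k => ¬ k.1.hi ≤ a) =
        Finset.univ.filter fun k => H.srcLabel M k = .source (H.region u w l r) p a := by
      ext k'
      simp only [Finset.mem_filter, hs, h.srcLabel_eq_iff hM hm he hb ha, Finset.mem_univ,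
        true_and]
      constructor
      · rintro ⟨⟨h1, h2⟩, h3⟩
        exact ⟨h1, (h.left.le_lo_or_hi_le h1 ha.1.1).resolve_right h3, h2⟩
      · rintro ⟨h1, h2, h3⟩
        exact ⟨⟨h1, h3⟩, fun hc => (k'.1.lo_lt_hi.trans_le hc).not_ge h2⟩
    rw [hset, hnet]
    ring

/-- In a flow, the flow across the left boundary of a face that is not the leftmost or the
rightmost one is the flow across its right boundary. -/
theorem IsCell.sum_left_eq_sum_right (h : H.IsCell u w l r) (hH : H.IsBoundedStronglyPlanar M)
    (hf : f ∈ (H.network M).flowPolytope) {k k' : H.DualEdge} (hk : k.1 ∈ H.arcEdges u w l)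
    (hk' : k'.1 ∈ H.arcEdges u w r) :
    ∑ k ∈ H.arcDuals u w l, f k = ∑ k ∈ H.arcDuals u w r, f k := by
  classical
  have hnet := ((mem_flowPolytope_iff H M).1 hf).2 (.face (H.region u w l r))
    ⟨k', Or.inr (tgtLabel_eq_face_iff.2 (h.leftFace_eq_iff.2 hk'))⟩
  rw [h.filter_tgtLabel_eq] at hnet
  by_cases hM : H.LeftMarked M (H.region u w l r)
  -- The sink absorbs the difference of the markings of `w` and `u`; the sources on the left
  -- boundary emit the same total, by `sum_left_eq` at the marked element `w`.
  · rw [IsCell.filter_srcLabel_eq_empty hM, h.netflowLabel_of_leftMarked hM,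
      Finset.sum_empty] at hnet
    rw [h.sum_left_eq hH hf hM hk h.left.top_mem (h.isMarked_of_leftMarked hH hM).2]
    · linarith
    · intro j
      rw [mem_arcDuals]
      exact ⟨fun hj => ⟨hj, h.left.le_top (h.left.hi_mem hj)⟩, fun hj => hj.1⟩
  · rw [h.filter_srcLabel_eq hM, IsCell.netflowLabel_of_not_leftMarked hM] at hnet
    linarith

end Flow

/-! ### Potentials -/

/-- The potential is controlled only below `w`. Overwriting its value at `w` by the one that `k`
dictates makes `f` a difference along the whole arc, since `k` is the only edge of the arc that ends
in `w`. -/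
theorem IsArc.sum_eq_of_hi_eq {u w : Phat P} {l : ℝ → ℝ} (h : H.IsArc u w l)
    {f : H.DualEdge → ℝ} {g : Phat P → ℝ}
    (hg : ∀ k : H.DualEdge, k.1.hi < w → f k = g k.1.hi - g k.1.lo) {k : H.DualEdge}
    (hk : k.1 ∈ H.arcEdges u w l) (hkw : k.1.hi = w) :
    ∑ j ∈ H.arcDuals u w l, f j = g k.1.lo + f k - g u := by
  classical
  let g' := Function.update g w (g k.1.lo + f k)
  have hne : ∀ v < w, g' v = g v := fun v hv => Function.update_of_ne hv.ne _ _
  have hw : g' w = g k.1.lo + f k := Function.update_self _ _ _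
  have hsum : ∑ j ∈ H.arcDuals u w l, (g' j.1.hi - g' j.1.lo) = g' w - g' u :=
    h.sum_eq_sub (ι := fun k : H.DualEdge => k.1) Subtype.val_injective
      (fun e he => h.exists_dualEdge hk he) g' h.bot_mem h.top_mem h.lt_top.le _ fun k => h.mem_arcDuals_iff
  rw [← hw, ← hne u h.lt_top, ← hsum]
  refine Finset.sum_congr rfl fun j hj => ?_
  rw [mem_arcDuals] at hj
  have hjw := h.le_top (h.hi_mem hj)
  rw [hne _ (j.1.lo_lt_hi.trans_le hjw)]
  rcases hjw.eq_or_lt with heq | hlt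
  · obtain rfl : j = k := Subtype.ext (h.edge_eq_of_hi_eq hj hk (heq.trans hkw.symm))
    rw [heq, hw]
    ring
  · rw [hne _ hlt, hg j hlt]

omit [Finite P] in
/-- Two edges that end in the same vertex do not change sides below it. -/
theorem curve_lt_curve {e e' : HEdge P} (hv : e.hi = e'.hi) {s t : ℝ}
    (hs : (H.pos e.lo).2 < s) (hs' : (H.pos e'.lo).2 < s) (hlt : H.curve e s < H.curve e' s)
    (hst : s ≤ t) (ht : t < (H.pos e.hi).2) : H.curve e t < H.curve e' t := by
  by_contra! hc
  have hsub : Icc s t ⊆ Ioo (H.pos e.lo).2 (H.pos e.hi).2 := fun y hy =>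
    ⟨hs.trans_le hy.1, hy.2.trans_lt ht⟩
  have hsub' : Icc s t ⊆ Ioo (H.pos e'.lo).2 (H.pos e'.hi).2 := fun y hy =>
    ⟨hs'.trans_le hy.1, hv ▸ hy.2.trans_lt ht⟩
  obtain ⟨y, hy, heq⟩ := isPreconnected_Icc.intermediate_value₂ (left_mem_Icc.2 hst)
    (right_mem_Icc.2 hst) ((H.curve_continuousOn e).mono (hsub.trans Ioo_subset_Icc_self))
    ((H.curve_continuousOn e').mono (hsub'.trans Ioo_subset_Icc_self)) hlt.le hc
  refine H.curve_ne_curve e e' ?_ y (hsub hy) (hsub' hy) heq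
  rintro rfl
  exact lt_irrefl _ hlt

/-- If an edge into `v` has another edge into `v` on its right, then `v` is the top of the face on
its right, and the last edge of the right boundary of this face is an edge into `v`. -/
theorem exists_isCell_of_curve_lt {v : Phat P} {s : ℝ} (hsv : s < (H.pos v).2)
    (hs : ∀ k : H.DualEdge, k.1.hi = v → (H.pos k.1.lo).2 < s) {k k' : H.DualEdge}
    (hk : k.1.hi = v) (hk' : k'.1.hi = v) (hlt : H.curve k.1 s < H.curve k'.1 s) :
    ∃ u l r, ∃ j : H.DualEdge, H.IsCell u v l r ∧ k.1 ∈ H.arcEdges u v l ∧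
      j.1 ∈ H.arcEdges u v r ∧ j.1.hi = v ∧ H.curve k.1 s < H.curve j.1 s := by
  obtain ⟨u, w, l, r, h, hkl⟩ := H.exists_isCell_right k.ne_right
  have hvl : v ∈ H.arcVerts u w l := hk ▸ h.left.hi_mem hkl
  have hus : (H.pos u).2 < s := (h.left.lo_mem hkl).1.1.trans_lt (hs k hk)
  -- The edge `k'` stays to the right of `l` and cannot enter the cell, so `r` is squeezed between
  -- `k` and `k'`. As these two meet at `v`, the cell closes there.
  have hr : ∀ t ∈ Ico s (H.pos v).2, l t < r t ∧ r t ≤ H.curve k'.1 t := by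
    intro t ht
    have htI : t ∈ Ioo (H.pos u).2 (H.pos w).2 :=
      ⟨hus.trans_le ht.1, ht.2.trans_le hvl.1.2⟩
    refine ⟨h.lt t htI, ?_⟩
    by_contra! hc
    refine h.notMem (H.curve k'.1 t, t) ⟨htI, ?_, hc⟩
      (H.curve_mem_drawing ⟨((hs k' hk').trans_le ht.1).le, hk' ▸ ht.2.le⟩)
    simp only
    rw [h.left.edge_eqOn hkl ⟨((hs k hk).trans_le ht.1).le, hk ▸ ht.2.le⟩]
    exact curve_lt_curve (hk.trans hk'.symm) (hs k hk) (hs k' hk') hlt ht.1 (hk ▸ ht.2)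
  have hvw : v = w := by
    refine IsArc.eq_of_height_eq hvl h.left.top_mem (le_antisymm hvl.1.2 ?_)
    by_contra! hc
    have h1 : l (H.pos v).2 < r (H.pos v).2 := h.lt _ ⟨hus.trans hsv, hc⟩
    have hcl := closure_Ico hsv.ne
    have h2 : r (H.pos v).2 ≤ H.curve k'.1 (H.pos v).2 := by
      refine le_on_closure (fun t ht => (hr t ht).2) h.right.continuous.continuousOn
        ((H.curve_continuousOn k'.1).mono ?_) (hcl ▸ right_mem_Icc.2 hsv.le)
      rw [hcl, hk']
      exact Icc_subset_Icc_left (hs k' hk').le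
    have h3 := H.curve_hi k'.1
    rw [hk'] at h3
    rw [h3, ← hvl.2] at h2
    exact h2.not_gt h1
  subst hvw
  obtain ⟨e, he, hev⟩ := h.right.exists_edge_hi_eq h.right.top_mem h.right.lt_top.ne'
  obtain ⟨hlr, hrk⟩ := hr s ⟨le_rfl, hsv⟩
  have hls : l s = H.curve k.1 s := h.left.edge_eqOn hkl ⟨(hs k hk).le, hk ▸ hsv.le⟩
  have hsI : s ∈ Ioo (H.pos ⊥).2 (H.pos ⊤).2 :=
    ⟨(H.height_mono bot_le).trans_lt hus, hsv.trans_le (H.height_mono le_top)⟩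
  -- At height `s` the arc `r` is strictly right of `k` and not right of `k'`, whereas the
  -- additional edges are strictly outside of both.
  obtain ⟨j, rfl⟩ : ∃ j : H.DualEdge, j.1 = e := by
    refine exists_dualEdge ?_ ?_
    · rintro rfl
      have h1 := h.right.edge_eqOn he (Ioo_subset_Icc_self hsI)
      have h2 := H.left_lt k.1 k.ne_left s ⟨hs k hk, hk ▸ hsv⟩
      linarith
    · rintro rfl
      have h1 := h.right.edge_eqOn he (Ioo_subset_Icc_self hsI)
      have h2 := H.lt_right k'.1 k'.ne_right s ⟨hs k' hk', hk' ▸ hsv⟩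
      linarith
  refine ⟨u, l, r, j, h, hkl, he, hev, ?_⟩
  rw [← h.right.edge_eqOn he ⟨(hs j hev).le, hev ▸ hsv.le⟩, ← hls]
  exact hlr

/-- A function on the dual edges that has the same sum over the left and the right boundary of
every face is the difference of a potential. -/
theorem exists_potential {f : H.DualEdge → ℝ}
    (hf : ∀ u w l r, H.IsCell u w l r → ∀ k k' : H.DualEdge, k.1 ∈ H.arcEdges u w l →
      k'.1 ∈ H.arcEdges u w r →
      ∑ k ∈ H.arcDuals u w l, f k = ∑ k ∈ H.arcDuals u w r, f k) (c : ℝ) :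
    ∃ g : Phat P → ℝ, g ⊥ = c ∧ ∀ k : H.DualEdge, f k = g k.1.hi - g k.1.lo := by
  classical
  have hpre : ∀ v : Phat P, v ≠ ⊥ → ∃ k : H.DualEdge, k.1.hi = v := by
    intro v hv
    obtain ⟨c, hc⟩ := exists_edge_hi hv
    exact ⟨H.dualEdge c, hc⟩
  choose pre hpre using hpre
  -- The potential is defined along one chosen edge into each element; the rest of the proof shows
  -- that the choice does not matter.
  let step : ∀ v : Phat P, (∀ v' < v, ℝ) → ℝ := fun v rec =>
    if h : v = ⊥ then c else rec (pre v h).1.lo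
      ((pre v h).1.lo_lt_hi.trans_eq (hpre v h)) + f (pre v h)
  let g : Phat P → ℝ := WellFounded.fix (wellFounded_lt (α := Phat P)) step
  have hg : ∀ v, g v = if h : v = ⊥ then c else g (pre v h).1.lo + f (pre v h) := fun v =>
    WellFounded.fix_eq _ step v
  refine ⟨g, by rw [hg]; simp, ?_⟩
  suffices key : ∀ v, ∀ k : H.DualEdge, k.1.hi = v → f k = g v - g k.1.lo from
    fun k => key _ k rfl
  intro v
  induction v using WellFoundedLT.induction with
  | ind v ih =>
  have ih' : ∀ k : H.DualEdge, k.1.hi < v → f k = g k.1.hi - g k.1.lo :=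
    fun k hk => ih _ hk k rfl
  -- At the height `s`, just below `v`, all edges into `v` are present and can be compared from left
  -- to right.
  obtain ⟨s, hs, hsv⟩ : ∃ s, (∀ k : H.DualEdge, k.1.hi = v → (H.pos k.1.lo).2 < s) ∧
      s < (H.pos v).2 := by
    have hev : ∀ᶠ s in 𝓝[<] (H.pos v).2, ∀ k : H.DualEdge, k.1.hi = v →
        (H.pos k.1.lo).2 < s := by
      refine eventually_all.2 fun k => ?_
      by_cases hk : k.1.hi = v
      · filter_upwards [Ioo_mem_nhdsLT (hk ▸ H.height_lo_lt_hi k.1)] with s hs _ using hs.1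
      · exact Eventually.of_forall fun s h => absurd h hk
    obtain ⟨s, h1, h2⟩ := (hev.and self_mem_nhdsWithin).exists
    exact ⟨s, h1, h2⟩
  have hstep : ∀ k k' : H.DualEdge, k.1.hi = v → k'.1.hi = v →
      H.curve k.1 s < H.curve k'.1 s → ∃ j : H.DualEdge, j.1.hi = v ∧
        H.curve k.1 s < H.curve j.1 s ∧ g j.1.lo + f j = g k.1.lo + f k := by
    intro k k' hk hk' hlt
    obtain ⟨u, l, r, j, h, hkl, hjr, hj, hlt'⟩ := exists_isCell_of_curve_lt hsv hs hk hk' hlt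
    refine ⟨j, hj, hlt', ?_⟩
    have h1 := h.left.sum_eq_of_hi_eq ih' hkl hk
    have h2 := h.right.sum_eq_of_hi_eq ih' hjr hj
    have h3 := hf u v l r h k j hkl hjr
    linarith
  have hall : ∀ k k' : H.DualEdge, k.1.hi = v → k'.1.hi = v →
      g k.1.lo + f k = g k'.1.lo + f k' := by
    intro k₁ k₂ hk₁ hk₂
    obtain ⟨m, hm, hmax⟩ := exists_max_image {k : H.DualEdge | k.1.hi = v}
      (fun k => H.curve k.1 s) (toFinite _) ⟨k₁, hk₁⟩
    suffices hm' : ∀ k : H.DualEdge, k.1.hi = v → g k.1.lo + f k = g m.1.lo + f m from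
      (hm' k₁ hk₁).trans (hm' k₂ hk₂).symm
    by_contra! hne
    -- Among the edges whose value differs from that of the rightmost edge `m`, let `j` be the
    -- rightmost. By `hstep` an edge further right has the same value as `j`, a contradiction.
    obtain ⟨j, ⟨hj, hjne⟩, hjmax⟩ := exists_max_image
      {k : H.DualEdge | k.1.hi = v ∧ g k.1.lo + f k ≠ g m.1.lo + f m}
      (fun k => H.curve k.1 s) (toFinite _) hne
    have hjm : H.curve j.1 s < H.curve m.1 s := by
      refine lt_of_le_of_ne (hmax j hj) (H.curve_ne_curve _ _ ?_ s ⟨hs j hj, ?_⟩ ⟨hs m hm, ?_⟩)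
      · exact fun hc => hjne (by rw [Subtype.ext hc])
      · exact (show j.1.hi = v from hj) ▸ hsv
      · exact (show m.1.hi = v from hm) ▸ hsv
    obtain ⟨i, hi, hlt, heq⟩ := hstep j m hj hm hjm
    exact (hjmax i ⟨hi, heq ▸ hjne⟩).not_gt hlt
  intro k hk
  have hv : v ≠ ⊥ := by
    rintro rfl
    exact not_lt_bot (hk ▸ k.1.lo_lt_hi)
  have h1 := hg v
  rw [dif_neg hv, hall _ k (hpre v hv) hk] at h1
  linarith

/-- Every flow consists of the differences of a point of the order polytope. -/
theorem exists_mem_orderPolytope (hH : H.IsBoundedStronglyPlanar M) {f : H.DualEdge → ℝ}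
    (hf : f ∈ (H.network M).flowPolytope) :
    ∃ x ∈ M.orderPolytope, ∀ k : H.DualEdge, f k = M.extend x k.1.hi - M.extend x k.1.lo := by
  classical
  obtain ⟨g, hbot, hg⟩ := exists_potential
    (fun u w l r h k k' hk hk' => h.sum_left_eq_sum_right hH hf hk hk') (M.mark ⊥)
  have hmark : ∀ v, M.IsMarked v → g v = M.mark v := by
    intro v
    induction v using WellFoundedLT.induction with
    | ind v ih =>
    intro hv
    by_cases hvb : v = ⊥
    · rw [hvb, hbot]
    · obtain ⟨c, hc⟩ := exists_edge_hi hvb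
      have hc' : (H.dualEdge c).1.hi = v := hc
      -- The marked element `v` is on the left boundary of this face, so the minimum `u` is marked
      -- by strong planarity, and the flow between `u` and `v` carries the induction.
      obtain ⟨u, w, l, r, h, hk⟩ := H.exists_isCell_right (H.dualEdge c).ne_right
      have hvl : v ∈ H.arcVerts u w l := hc' ▸ h.left.hi_mem hk
      have hM := h.leftMarked_iff.2 ⟨v, hvl, hv⟩
      have hu := (h.isMarked_of_leftMarked hH hM).1
      have huv : u < v := (h.left.bot_le (h.left.lo_mem hk)).trans_lt
        (hc' ▸ (H.dualEdge c).1.lo_lt_hi)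
      let s : Finset H.DualEdge :=
        Finset.univ.filter fun k => k.1 ∈ H.arcEdges u w l ∧ k.1.hi ≤ v
      have h1 := h.sum_left_eq hH hf hM hk hvl hv (s := s) (by simp [s])
      have h2 := h.left.sum_eq_sub (ι := fun k : H.DualEdge => k.1) Subtype.val_injective
        (fun e he => h.left.exists_dualEdge hk he) g h.left.bot_mem hvl huv.le s (by
          intro k
          simp only [s, Finset.mem_filter, Finset.mem_univ, true_and]
          exact ⟨fun hh => ⟨hh.1, h.left.bot_le (h.left.lo_mem hh.1), hh.2⟩,
            fun hh => ⟨hh.1, hh.2.2⟩⟩)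
      rw [Finset.sum_congr rfl fun k _ => hg k, h2, ih u huv hu] at h1
      linarith
  let x : P → ℝ := fun p => g ((p : WithTop P) : Phat P)
  have hx : M.extend x = g := by
    funext v
    induction v using WithBot.recBotCoe with
    | bot => exact hbot.symm
    | coe v =>
      induction v using WithTop.recTopCoe with
      | top => exact (hmark ⊤ M.isMarked_top).symm
      | coe p => rfl
  have hmono : Monotone g := by
    have := Fintype.ofFinite (Phat P)
    let _ : LocallyFiniteOrder (Phat P) := Fintype.toLocallyFiniteOrder
    rw [monotone_iff_forall_covBy]
    intro a b hab
    have h1 := ((mem_flowPolytope_iff H M).1 hf).1 (H.dualEdge ⟨(a, b), hab⟩)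
    rw [hg] at h1
    exact sub_nonneg.1 h1
  refine ⟨x, M.mem_orderPolytope_of_monotone (hx ▸ hmono) (hx ▸ hmark), ?_⟩
  rw [hx]
  exact hg

end BoundedEmbedding

/-! ### Integrality of the order polytope -/

namespace MarkedPoset

variable {P : Type*} [PartialOrder P] (M : MarkedPoset P)

/-- A coordinate of the extended vector, as an affine function of the vector. -/
def extendAffine : Phat P → ((P → ℝ) →ᵃ[ℝ] ℝ) :=
  WithBot.recBotCoe (AffineMap.const ℝ (P → ℝ) (⨅ a : M.A, M.lam a))
    (WithTop.recTopCoe (AffineMap.const ℝ (P → ℝ) (⨆ a : M.A, M.lam a))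
      fun p => (LinearMap.proj p : (P → ℝ) →ₗ[ℝ] ℝ).toAffineMap)

theorem extendAffine_apply (v : Phat P) (x : P → ℝ) : M.extendAffine v x = M.extend x v := by
  induction v using WithBot.recBotCoe with
  | bot => rfl
  | coe v =>
    induction v using WithTop.recTopCoe with
    | top => rfl
    | coe p => rfl

theorem convex_orderPolytope : Convex ℝ M.orderPolytope := by
  intro x hx y hy a b ha hb hab
  refine ⟨fun p q hpq => ?_, fun c => ?_⟩
  · have h1 := mul_le_mul_of_nonneg_left (hx.1 p q hpq) ha
    have h2 := mul_le_mul_of_nonneg_left (hy.1 p q hpq) hb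
    simpa using add_le_add h1 h2
  · simp [hx.2 c, hy.2 c, ← add_mul, hab]

theorem isClosed_orderPolytope : IsClosed M.orderPolytope := by
  have h : M.orderPolytope = (⋂ (p : P) (q : P) (_ : p < q), {x : P → ℝ | x p ≤ x q}) ∩
      ⋂ a : M.A, {x : P → ℝ | x a = M.lam a} := by
    ext x
    simp [orderPolytope]
  rw [h]
  refine IsClosed.inter (isClosed_iInter fun p => isClosed_iInter fun q => isClosed_iInter
    fun _ => isClosed_le (continuous_apply p) (continuous_apply q)) (isClosed_iInter fun a =>
      isClosed_eq (continuous_apply _) continuous_const)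

variable [Finite P] [Nonempty P]

theorem orderPolytope_subset_Icc :
    M.orderPolytope ⊆ Icc (fun _ => ⨅ a : M.A, M.lam a) (fun _ => ⨆ a : M.A, M.lam a) :=
  fun _ hx => ⟨fun p => M.monotone_extend hx (bot_le : ⊥ ≤ ((p : WithTop P) : Phat P)),
    fun p => M.monotone_extend hx (le_top : ((p : WithTop P) : Phat P) ≤ ⊤)⟩

theorem isCompact_orderPolytope : IsCompact M.orderPolytope :=
  isCompact_Icc.of_isClosed_subset M.isClosed_orderPolytope M.orderPolytope_subset_Icc

variable {M}

omit [Nonempty P] in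
/-- The vertices of a marked order polytope with integral marking are integral. -/
theorem extremePoints_subset_intLattice (hM : ∀ a : M.A, ∃ n : ℤ, M.lam a = n) :
    M.orderPolytope.extremePoints ℝ ⊆ intLattice P := by
  classical
  intro x hx p₀
  by_contra! hp₀
  have hθ : Int.fract (x p₀) ≠ 0 := fun hc => by
    obtain ⟨n, hn⟩ := Int.fract_eq_zero_iff.1 hc
    exact hp₀ n hn.symm
  -- `ε` is at most the smallest positive gap between two coordinates, so a shift of some
  -- coordinates by `ε` reverses no strict inequality.
  obtain ⟨ε, hε, hε0⟩ : ∃ ε : ℝ, (∀ p q, x p < x q → x p + ε ≤ x q) ∧ 0 < ε := by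
    have hev : ∀ᶠ ε in 𝓝[>] (0 : ℝ), ∀ p q, x p < x q → x p + ε ≤ x q := by
      refine eventually_all.2 fun p => eventually_all.2 fun q => ?_
      by_cases h : x p < x q
      · filter_upwards [Ioo_mem_nhdsGT (sub_pos.2 h)] with ε hε _
        linarith [hε.2]
      · exact Eventually.of_forall fun _ h' => absurd h' h
    exact (hev.and self_mem_nhdsWithin).exists
  -- Coordinates with the fractional part of `x p₀` move together. Equal coordinates stay equal, and
  -- marked ones, being integers, stay fixed. So `x` is the midpoint of `x + d` and `x - d`.
  let d : P → ℝ := fun p => if Int.fract (x p) = Int.fract (x p₀) then ε else 0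
  have hd0 : ∀ p, 0 ≤ d p ∧ d p ≤ ε := fun p => by
    simp only [d]
    split_ifs <;> constructor <;> linarith
  have hd : ∀ p q, x p = x q → d p = d q := fun p q h => by simp only [d, h]
  have hA : ∀ a : M.A, d a = 0 := fun a => by
    obtain ⟨n, hn⟩ := hM a
    have h0 : Int.fract (x a) = 0 := by rw [hx.1.2 a, hn, Int.fract_intCast]
    simp only [d, h0]
    exact if_neg (Ne.symm hθ)
  have hmem : ∀ s : ℝ, |s| = 1 → (fun p => x p + s * d p) ∈ M.orderPolytope := by
    intro s hs
    refine ⟨fun p q hpq => ?_, fun a => by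
      simp only [hA, mul_zero, add_zero, hx.1.2 a]⟩
    rcases (hx.1.1 p q hpq).eq_or_lt with h | h
    · simp only [h, hd p q h, le_refl]
    · have h1 := hε p q h
      have h2 := hd0 p
      have h3 := hd0 q
      rcases eq_or_eq_neg_of_abs_eq hs with rfl | rfl <;> linarith
  have hne := (mem_extremePoints.1 hx).2 _ (hmem 1 (by simp)) _ (hmem (-1) (by simp))
    ⟨1 / 2, 1 / 2, by norm_num, by norm_num, by norm_num, by
      funext p
      simp only [Pi.add_apply, Pi.smul_apply, smul_eq_mul]
      ring⟩
  have h1 := congrFun hne.1 p₀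
  simp only [d, if_true] at h1
  linarith

theorem isIntegralPolytope_orderPolytope (hM : ∀ a : M.A, ∃ n : ℤ, M.lam a = n) :
    IsIntegralPolytope M.orderPolytope := by
  have hfin : (M.orderPolytope ∩ intLattice P).Finite := by
    refine (Finite.pi fun _ : P => (finite_Icc ⌈⨅ a : M.A, M.lam a⌉
      ⌊⨆ a : M.A, M.lam a⌋).image ((↑) : ℤ → ℝ)).subset ?_
    rintro x ⟨hx, hxZ⟩ p -
    obtain ⟨n, hn⟩ := hxZ p
    have h := M.orderPolytope_subset_Icc hx
    exact ⟨n, ⟨Int.ceil_le.2 (hn ▸ h.1 p), Int.le_floor.2 (hn ▸ h.2 p)⟩, hn.symm⟩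
  refine ⟨_, hfin, inter_subset_right, subset_antisymm ?_
    (convexHull_min inter_subset_left M.convex_orderPolytope)⟩
  -- By Krein–Milman the polytope is the closed hull of its extreme points. These are among its
  -- finitely many lattice points, whose convex hull is already closed.
  refine (closure_convexHull_extremePoints M.isCompact_orderPolytope
    M.convex_orderPolytope).symm.subset.trans
    (closure_minimal (convexHull_mono ?_) (hfin.isClosed_convexHull ℝ))
  exact subset_inter extremePoints_subset (extremePoints_subset_intLattice hM)

theorem exists_int_extend_eq (hM : ∀ a : M.A, ∃ n : ℤ, M.lam a = n) {x : P → ℝ}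
    (hx : x ∈ intLattice P) (v : Phat P) : ∃ n : ℤ, M.extend x v = n := by
  have := M.nonempty_marked
  induction v using WithBot.recBotCoe with
  | bot =>
    obtain ⟨a, ha⟩ := exists_eq_ciInf_of_finite (f := M.lam)
    obtain ⟨n, hn⟩ := hM a
    exact ⟨n, ha.symm.trans hn⟩
  | coe v =>
    induction v using WithTop.recTopCoe with
    | top =>
      obtain ⟨a, ha⟩ := exists_eq_ciSup_of_finite (f := M.lam)
      obtain ⟨n, hn⟩ := hM a
      exact ⟨n, ha.symm.trans hn⟩
    | coe p => exact hx p

end MarkedPoset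

/-! ### Integral equivalences from injective affine maps -/

theorem IsIntegralPolytope.image {ι κ : Type*} {S : Set (ι → ℝ)} (hS : IsIntegralPolytope S)
    (φ : (ι → ℝ) →ᵃ[ℝ] (κ → ℝ)) (hφ : ∀ x ∈ intLattice ι, φ x ∈ intLattice κ) :
    IsIntegralPolytope (φ '' S) := by
  obtain ⟨V, hV, hVZ, rfl⟩ := hS
  refine ⟨φ '' V, hV.image φ, ?_, φ.image_convexHull V⟩
  rintro _ ⟨x, hx, rfl⟩
  exact hφ x (hVZ hx)

/-- An injective affine map that preserves and reflects lattice points is an integral equivalence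
between an integral polytope and its image. -/
theorem IsIntegralPolytope.isIntegralEquivalence {ι κ : Type*} {S : Set (ι → ℝ)}
    (hS : IsIntegralPolytope S) (φ : (ι → ℝ) →ᵃ[ℝ] (κ → ℝ)) (hinj : Function.Injective φ)
    (hφ : ∀ x, φ x ∈ intLattice κ ↔ x ∈ intLattice ι) :
    IsIntegralEquivalence φ S (φ '' S) where
  integral_left := hS
  integral_right := hS.image φ fun x => (hφ x).2
  bijOn := hinj.injOn.bijOn_image
  bijOn_lattice := by
    rw [← AffineSubspace.map_span, AffineSubspace.coe_map]
    refine ⟨fun x hx => ⟨(hφ x).2 hx.1, mem_image_of_mem φ hx.2⟩, hinj.injOn, ?_⟩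
    rintro _ ⟨hZ, x, hx, rfl⟩
    exact ⟨x, ⟨(hφ x).1 hZ, hx⟩, rfl⟩

/-! ### The map `Γ` -/

namespace BoundedEmbedding

variable {P : Type*} [PartialOrder P] (H : BoundedEmbedding P) (M : MarkedPoset P)

/-- The affine map that sends a vector to its differences along the edges. -/
def differenceMap : (P → ℝ) →ᵃ[ℝ] (H.DualEdge → ℝ) :=
  AffineMap.pi fun k => M.extendAffine k.1.hi - M.extendAffine k.1.lo

theorem differenceMap_apply (x : P → ℝ) (k : H.DualEdge) :
    H.differenceMap M x k = M.extend x k.1.hi - M.extend x k.1.lo := by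
  rw [← M.extendAffine_apply, ← M.extendAffine_apply]
  rfl

variable [Finite P]

/-- An element of `Phat P` other than the smallest one is reached by an edge. -/
theorem exists_dualEdge_hi_eq {v : Phat P} (hv : v ≠ ⊥) : ∃ k : H.DualEdge, k.1.hi = v := by
  obtain ⟨c, hc⟩ := exists_edge_hi hv
  exact ⟨H.dualEdge c, hc⟩

/-- The value at `⊥` depends only on the marking, and the value at any other element follows from a
lower one through an edge into it. -/
theorem differenceMap_injective : Function.Injective (H.differenceMap M) := by
  intro x y hxy
  suffices h : ∀ v, M.extend x v = M.extend y v from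
    funext fun p => h ((p : WithTop P) : Phat P)
  intro v
  induction v using WellFoundedLT.induction with
  | ind v ih =>
  by_cases hv : v = ⊥
  · subst hv
    rfl
  · obtain ⟨k, rfl⟩ := H.exists_dualEdge_hi_eq hv
    have h := congrFun hxy k
    rw [differenceMap_apply, differenceMap_apply, ih _ k.1.lo_lt_hi] at h
    exact sub_left_injective h

theorem differenceMap_mem_intLattice_iff [Nonempty P]
    (hM : ∀ a : M.A, ∃ n : ℤ, M.lam a = n) (x : P → ℝ) :
    H.differenceMap M x ∈ intLattice H.DualEdge ↔ x ∈ intLattice P := by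
  constructor
  · intro hx
    suffices h : ∀ v, ∃ n : ℤ, M.extend x v = n from fun p => h ((p : WithTop P) : Phat P)
    intro v
    induction v using WellFoundedLT.induction with
    | ind v ih =>
    by_cases hv : v = ⊥
    · subst hv
      -- The value at `⊥` is the same for all vectors, so it may be read off from the lattice point
      -- `0`.
      exact MarkedPoset.exists_int_extend_eq hM (x := 0) (fun _ => ⟨0, by simp⟩) ⊥
    · obtain ⟨k, rfl⟩ := H.exists_dualEdge_hi_eq hv
      obtain ⟨m, hm⟩ := ih _ k.1.lo_lt_hi
      obtain ⟨n, hn⟩ := hx k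
      rw [differenceMap_apply, hm] at hn
      exact ⟨n + m, by push_cast; linarith⟩
  · intro hx k
    obtain ⟨m, hm⟩ := MarkedPoset.exists_int_extend_eq hM hx k.1.hi
    obtain ⟨n, hn⟩ := MarkedPoset.exists_int_extend_eq hM hx k.1.lo
    exact ⟨m - n, by rw [differenceMap_apply, hm, hn]; push_cast; ring⟩

variable {H M} in
theorem image_differenceMap [Nonempty P] (hH : H.IsBoundedStronglyPlanar M) :
    H.differenceMap M '' M.orderPolytope = (H.network M).flowPolytope := by
  refine subset_antisymm ?_ fun f hf => ?_
  · rintro _ ⟨x, hx, rfl⟩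
    have h := sub_mem_flowPolytope hH (M.monotone_extend hx) fun v => M.extend_eq_mark hx.2
    rwa [← funext (H.differenceMap_apply M x)] at h
  · obtain ⟨x, hx, hfx⟩ := exists_mem_orderPolytope hH hf
    exact ⟨x, hx, funext fun k => by rw [differenceMap_apply, hfx]⟩

end BoundedEmbedding

end

theorem theorem1p2 {P : Type*} [PartialOrder P] [Finite P] [Nonempty P]
    (M : MarkedPoset P) (H : BoundedEmbedding P) (hH : H.IsBoundedStronglyPlanar M) :
    ∃ φ : (P → ℝ) →ᵃ[ℝ] (H.DualEdge → ℝ),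
      (∀ (x : P → ℝ) (e : H.DualEdge), φ x e = M.extend x e.1.hi - M.extend x e.1.lo) ∧
      Set.BijOn φ M.orderPolytope (H.network M).flowPolytope ∧
      ((∀ a : M.A, ∃ n : ℤ, M.lam a = n) →
        IsIntegralEquivalence φ M.orderPolytope (H.network M).flowPolytope) := by
  rw [← BoundedEmbedding.image_differenceMap hH]
  have hinj := H.differenceMap_injective M
  exact ⟨H.differenceMap M, H.differenceMap_apply M, hinj.injOn.bijOn_image, fun hM =>
    (MarkedPoset.isIntegralPolytope_orderPolytope hM).isIntegralEquivalence _ hinj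
      (H.differenceMap_mem_intLattice_iff M hM)⟩
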